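/- All abelian varieties are over $\mathbb C$. For an abelian variety $A$, the Hodge group $G(A)$ is the smallest algebraic subgroup of $GL(H^1(A,\mathbb Q))$ defined over $\mathbb Q$ whose group of complex points contains all the automorphisms of $H^1(A,\mathbb C)$ induced by multiplication by $u$, $|u|=1$, on the universal covering space of $A$; it acts on $H^\star(A,\mathbb Q)=\bigwedge^\star H^1(A,\mathbb Q)$. For abelian varieties $A$, $B$ we have $G(A\times B)\subseteq G(A)\times G(B)$. A Hodge structure $V_{\mathbb C}=\bigoplus_{p+q=n}V^{p,q}$ is effective if $V^{p,q}=0$ unless $p,q\ge 0$. Its Tate twist $V(m)$ is the Hodge structure of weight $n-2m$ with $V(m)^{p,q}=V^{p+m,q+m}$. It is fully twisted if $V$ is effective but $V(1)$ is not. Let $\mathcal A$ be a class of abelian varieties, let $A$ be an abelian variety, and let $k$ be a subfield of $\mathbb C$. * $A$ is *dominated* by $\mathcal A$ if, given any irreducible Hodge structure $V$ in the cohomology of $A$, there exists a fully twisted Hodge structure $V'$ in the cohomology of some $X\in\mathcal A$ such that $V'$ is isomorphic to a Tate twist of $V$. * $A$ is *$k$-dominated* by $\mathcal A$ if, given any irreducible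 $G(A)_k$-submodule $V$ of $H^\star(A,k)$, there exist $B\in\mathcal A$, an integer $n \ge 0$ and a $G(B)_k$-submodule $V'$ of $H^n(B,k)$ such that $V$ and $V'$ are isomorphic as $G(A\times B)_k$-modules and $V'_{\mathbb C}$ contains a nonzero $(n,0)$-form. **Lemma.** If $A$ is $k$-dominated by $\mathcal A$ for some subfield $k$ of $\mathbb C$, then $A$ is dominated by $\mathcal A$. -/

import Mathlib

open scoped TensorProduct

noncomputable section

/-! ### Rational Hodge structures -/

/-- Complex conjugation `z ⊗ w ↦ conj z ⊗ w` on the complexification of a rational vector space. -/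
def conjC (W : Type*) [AddCommGroup W] [Module ℚ W] : (ℂ ⊗[ℚ] W) →ₗ[ℚ] (ℂ ⊗[ℚ] W) :=
  LinearMap.rTensor W (Complex.conjAe.toLinearMap.restrictScalars ℚ)

/-- A (rational, pure) Hodge structure on `W`: a decomposition of `W_ℂ` into subspaces
`W^{p,q}`, `p + q = weight`, with `conj W^{p,q} = W^{q,p}`. -/
structure HodgeStructure (W : Type*) [AddCommGroup W] [Module ℚ W] where
  weight : ℤ
  piece : ℤ → ℤ → Submodule ℂ (ℂ ⊗[ℚ] W)
  finite : FiniteDimensional ℚ W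
  piece_eq_bot : ∀ p q, p + q ≠ weight → piece p q = ⊥
  isInternal : DirectSum.IsInternal (fun pq : ℤ × ℤ => piece pq.1 pq.2)
  conj_mem : ∀ p q x, x ∈ piece p q → conjC W x ∈ piece q p

namespace HodgeStructure

variable {W : Type*} [AddCommGroup W] [Module ℚ W]
variable {W' : Type*} [AddCommGroup W'] [Module ℚ W']

/-- The Tate twist `W(m)`, of weight `n - 2m`, with `W(m)^{p,q} = W^{p+m,q+m}`. -/
def tateTwist (S : HodgeStructure W) (m : ℤ) : HodgeStructure W where
  weight := S.weight - 2 * m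
  piece p q := S.piece (p + m) (q + m)
  finite := S.finite
  piece_eq_bot p q h := S.piece_eq_bot _ _ (by omega)
  isInternal := by
    have h := S.isInternal
    rw [DirectSum.isInternal_submodule_iff_iSupIndep_and_iSup_eq_top] at h ⊢
    let e : ℤ × ℤ ≃ ℤ × ℤ := (Equiv.addRight m).prodCongr (Equiv.addRight m)
    refine ⟨h.1.comp e.injective, ?_⟩
    rw [← h.2]
    exact e.iSup_comp (g := fun pq : ℤ × ℤ => S.piece pq.1 pq.2)
  conj_mem p q x hx := S.conj_mem _ _ x hx

/-- `W^{p,q} = 0` unless `p, q ≥ 0`. -/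
def IsEffective (S : HodgeStructure W) : Prop :=
  ∀ p q, S.piece p q ≠ ⊥ → 0 ≤ p ∧ 0 ≤ q

/-- `W` is effective but `W(1)` is not. -/
def IsFullyTwisted (S : HodgeStructure W) : Prop :=
  S.IsEffective ∧ ¬ (S.tateTwist 1).IsEffective

/-- Isomorphism of rational Hodge structures. -/
def Isomorphic (S : HodgeStructure W) (S' : HodgeStructure W') : Prop :=
  S.weight = S'.weight ∧ ∃ e : W ≃ₗ[ℚ] W', ∀ p q,
    (S.piece p q).map (e.toLinearMap.baseChange ℂ) = S'.piece p q

/-- `T` makes the subspace `U` a Hodge substructure: the inclusion respects weights and types. -/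
def IsSubstructure (S : HodgeStructure W) (U : Submodule ℚ W) (T : HodgeStructure U) : Prop :=
  T.weight = S.weight ∧ ∀ p q, (T.piece p q).map (U.subtype.baseChange ℂ) ≤ S.piece p q

/-- `W ≠ 0`, and the only Hodge substructures are `0` and `W`. -/
def IsIrreducible (S : HodgeStructure W) : Prop :=
  Nontrivial W ∧ ∀ (U : Submodule ℚ W) (T : HodgeStructure U), S.IsSubstructure U T →
    U = ⊥ ∨ U = ⊤

end HodgeStructure

/-! ### Complex abelian varieties and their cohomology -/

/-- A complex abelian variety, as a complex torus `V / Λ` which admits a Riemann form: `Λ` is the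
`ℤ`-span of an `ℝ`-basis of `V`, and there is an alternating real form `E` on `V`, integral on `Λ`,
with `E (iu) (iv) = E u v` and `E u (iu) > 0` for `u ≠ 0`. -/
structure ComplexAbelianVariety where
  V : Type
  [addCommGroup : AddCommGroup V]
  [module : Module ℂ V]
  [finiteDimensional : FiniteDimensional ℂ V]
  lattice : Submodule ℤ V
  exists_basis : ∃ (n : ℕ) (b : Module.Basis (Fin n) ℝ V),
    lattice = Submodule.span ℤ (Set.range b)
  exists_riemannForm : ∃ E : V →ₗ[ℝ] V →ₗ[ℝ] ℝ,
    (∀ u, E u u = 0) ∧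
    (∀ u v, E (Complex.I • u) (Complex.I • v) = E u v) ∧
    (∀ u ∈ lattice, ∀ v ∈ lattice, ∃ m : ℤ, E u v = m) ∧
    (∀ u, u ≠ 0 → 0 < E u (Complex.I • u))

/-- Scalars from `ℝ` and from a field `k → ℂ` commute on `ℂ`. -/
instance smulCommClass_real_complex (k : Type*) [Field k] [Algebra k ℂ] :
    SMulCommClass ℝ k ℂ :=
  ⟨fun r a z => by simp only [Algebra.smul_def, Complex.coe_algebraMap]; ring⟩

namespace ComplexAbelianVariety

attribute [instance] addCommGroup module finiteDimensional

/-- The product `A × B`. -/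
def prod (A B : ComplexAbelianVariety) : ComplexAbelianVariety where
  V := A.V × B.V
  lattice := A.lattice.prod B.lattice
  exists_basis := by
    obtain ⟨n, b, hb⟩ := A.exists_basis
    obtain ⟨m, c, hc⟩ := B.exists_basis
    refine ⟨n + m, (b.prod c).reindex finSumFinEquiv, ?_⟩
    rw [Module.Basis.range_reindex, hb, hc]
    have : Set.range (b.prod c) = (LinearMap.inl ℤ A.V B.V) '' Set.range b ∪
        (LinearMap.inr ℤ A.V B.V) '' Set.range c := by
      ext x
      constructor
      · rintro ⟨i | i, rfl⟩
        · left; exact ⟨b i, ⟨i, rfl⟩, by ext <;> simp⟩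
        · right; exact ⟨c i, ⟨i, rfl⟩, by ext <;> simp⟩
      · rintro (⟨_, ⟨i, rfl⟩, rfl⟩ | ⟨_, ⟨i, rfl⟩, rfl⟩)
        · exact ⟨Sum.inl i, by ext <;> simp⟩
        · exact ⟨Sum.inr i, by ext <;> simp⟩
    rw [this, LinearMap.span_inl_union_inr]
  exists_riemannForm := by
    obtain ⟨E, h1, h2, h3, h4⟩ := A.exists_riemannForm
    obtain ⟨F, k1, k2, k3, k4⟩ := B.exists_riemannForm
    refine ⟨E.compl₁₂ (LinearMap.fst ℝ A.V B.V) (LinearMap.fst ℝ A.V B.V) +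
      F.compl₁₂ (LinearMap.snd ℝ A.V B.V) (LinearMap.snd ℝ A.V B.V), ?_, ?_, ?_, ?_⟩
    · intro u; simp [h1, k1]
    · intro u v; simp [h2, k2]
    · intro u hu v hv
      obtain ⟨m, hm⟩ := h3 _ hu.1 _ hv.1
      obtain ⟨n, hn⟩ := k3 _ hu.2 _ hv.2
      exact ⟨m + n, by simp [hm, hn]⟩
    · rintro ⟨u, v⟩ huv
      have hu : 0 ≤ E u (Complex.I • u) := by
        by_cases h : u = 0
        · simp [h]
        · exact (h4 u h).le
      have hv : 0 ≤ F v (Complex.I • v) := by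
        by_cases h : v = 0
        · simp [h]
        · exact (k4 v h).le
      by_cases h : u = 0
      · have h' : v ≠ 0 := fun h' => huv (by simp [h, h'])
        simpa [h] using k4 v h'
      · simpa using add_pos_of_pos_of_nonneg (h4 u h) hv

variable (A : ComplexAbelianVariety)

/-- `H¹(A, ℂ) = Hom_ℝ(V, ℂ) = Hom(Λ, ℂ)`. -/
abbrev H1 : Type := A.V →ₗ[ℝ] ℂ

/-- `H^⋆(A, ℂ)`, the exterior algebra of `H¹(A, ℂ)`. -/
abbrev Coh : Type := ExteriorAlgebra ℂ A.H1

section rational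

variable (k : Type*) [Field k] [Algebra k ℂ]

/-- `H¹(A, k) = Hom(Λ, k)`: the classes in `H¹(A, ℂ)` whose periods (values on `Λ`) lie in `k`. -/
def H1Over : Submodule k A.H1 where
  carrier := {φ | ∀ v ∈ A.lattice, φ v ∈ (algebraMap k ℂ).range}
  zero_mem' v _ := zero_mem _
  add_mem' hx hy v hv := add_mem (hx v hv) (hy v hv)
  smul_mem' c x hx v hv := by
    rw [LinearMap.smul_apply, Algebra.smul_def]
    exact mul_mem ⟨c, rfl⟩ (hx v hv)

/-- `Hⁿ(A, k) = ⋀ⁿ H¹(A, k)`, inside `H^⋆(A, ℂ)`. -/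
def cohOver (n : ℕ) : Submodule k A.Coh :=
  ((A.H1Over k).map ((ExteriorAlgebra.ι ℂ (M := A.H1)).restrictScalars k)) ^ n

/-- `H^⋆(A, k) = ⨁ₙ Hⁿ(A, k)`, inside `H^⋆(A, ℂ)`. -/
def totalCohOver : Submodule k A.Coh := ⨆ n, A.cohOver k n

variable {A k} in
/-- The natural map from `V_ℂ = ℂ ⊗ V` to `H^⋆(A, ℂ)`, for a `k`-subspace `V` of `H^⋆(A, ℂ)`.
It is injective when `V` is contained in `H^⋆(A, k)`. -/
def toComplex (V : Submodule k A.Coh) : (ℂ ⊗[k] V) →ₗ[ℂ] A.Coh :=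
  V.subtype.liftBaseChange ℂ

end rational

/-- `H^{1,0}(A)`: the `ℂ`-linear forms on `V`. -/
def H10 : Submodule ℂ A.H1 where
  carrier := {φ | ∀ (c : ℂ) v, φ (c • v) = c * φ v}
  zero_mem' := by simp
  add_mem' hx hy c v := by simp [hx c v, hy c v, mul_add]
  smul_mem' a x hx c v := by simp [hx c v, mul_left_comm]

/-- `H^{0,1}(A)`: the conjugate-linear forms on `V`. -/
def H01 : Submodule ℂ A.H1 where
  carrier := {φ | ∀ (c : ℂ) v, φ (c • v) = (starRingEnd ℂ) c * φ v}
  zero_mem' := by simp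
  add_mem' hx hy c v := by simp [hx c v, hy c v, mul_add]
  smul_mem' a x hx c v := by simp [hx c v, mul_left_comm]

/-- `H^{p,q}(A) = ⋀ᵖ H^{1,0} ∧ ⋀^q H^{0,1}`, for natural numbers `p`, `q`. -/
def hodgeNat (p q : ℕ) : Submodule ℂ A.Coh :=
  (A.H10.map (ExteriorAlgebra.ι ℂ)) ^ p * (A.H01.map (ExteriorAlgebra.ι ℂ)) ^ q

/-- `H^{p,q}(A)`, the zero space if `p < 0` or `q < 0`. -/
def hodge (p q : ℤ) : Submodule ℂ A.Coh :=
  if 0 ≤ p ∧ 0 ≤ q then A.hodgeNat p.toNat q.toNat else ⊥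

variable {A} in
/-- `S` is a Hodge structure in the cohomology of `A`: `W` is a subspace of `Hⁿ(A, ℚ)` and `S`
is the structure of weight `n` on it with `W^{p,q} ⊆ H^{p,q}(A)`. -/
def IsHodgeSub (n : ℕ) (W : Submodule ℚ A.Coh) (S : HodgeStructure W) : Prop :=
  W ≤ A.cohOver ℚ n ∧ S.weight = n ∧
    ∀ p q, (S.piece p q).map (toComplex W) ≤ A.hodge p q

/-- `A` is dominated by the class `𝒜`: each irreducible Hodge structure in the cohomology of `A`
has a Tate twist isomorphic to a fully twisted Hodge structure in the cohomology of a member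
of `𝒜`. -/
def IsDominatedBy (𝒜 : Set ComplexAbelianVariety) : Prop :=
  ∀ (n : ℕ) (W : Submodule ℚ A.Coh) (S : HodgeStructure W), IsHodgeSub n W S → S.IsIrreducible →
    ∃ X ∈ 𝒜, ∃ (n' : ℕ) (W' : Submodule ℚ X.Coh) (S' : HodgeStructure W'),
      IsHodgeSub n' W' S' ∧ S'.IsFullyTwisted ∧ ∃ m : ℤ, S'.Isomorphic (S.tateTwist m)

/-! ### The Hodge group -/

/-- `G`, a group of complex points, is an algebraic subgroup of `GL(H¹(A, ℚ))` defined over `ℚ`: it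
is cut out in `GL(H¹(A, ℂ))` by polynomials with rational coefficients in the matrix entries, with
respect to a basis of `H¹(A, ℚ)`. (In characteristic zero algebraic groups are reduced, so that a
`ℚ`-group is determined by its complex points.) -/
def IsRationalAlgebraic (G : Subgroup (A.H1 ≃ₗ[ℂ] A.H1)) : Prop :=
  ∃ (d : ℕ) (b : Module.Basis (Fin d) ℂ A.H1) (P : Set (MvPolynomial (Fin d × Fin d) ℚ)),
    (∀ i, b i ∈ A.H1Over ℚ) ∧
    ∀ g : A.H1 ≃ₗ[ℂ] A.H1, g ∈ G ↔ ∀ f ∈ P,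
      MvPolynomial.aeval (fun ij => LinearMap.toMatrix b b g.toLinearMap ij.1 ij.2) f = 0

/-- The Hodge group `G(A)`, through its group of complex points: the smallest algebraic subgroup of
`GL(H¹(A, ℚ))`, defined over `ℚ`, which contains the automorphisms of `H¹` induced by
multiplication by the complex numbers `u` with `|u| = 1` on `V`. -/
def hodgeGroup : Subgroup (A.H1 ≃ₗ[ℂ] A.H1) :=
  sInf {G | A.IsRationalAlgebraic G ∧
    ∀ g : A.H1 ≃ₗ[ℂ] A.H1, (∃ u : ℂ, ‖u‖ = 1 ∧ ∀ φ v, g φ v = φ (u • v)) → g ∈ G}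

variable {A} in
/-- The action of `GL(H¹(A, ℂ))` on `H^⋆(A, ℂ)`. -/
def act (g : A.H1 ≃ₗ[ℂ] A.H1) : A.Coh →ₗ[ℂ] A.Coh :=
  (ExteriorAlgebra.map g.toLinearMap).toLinearMap

variable {A} {B : ComplexAbelianVariety} in
/-- The element `(g, h)` of `GL(H¹(A)) × GL(H¹(B))`, acting on `H¹(A × B) = H¹(A) ⊕ H¹(B)`. -/
def blockSum (g : A.H1 ≃ₗ[ℂ] A.H1) (h : B.H1 ≃ₗ[ℂ] B.H1) :
    (A.prod B).H1 ≃ₗ[ℂ] (A.prod B).H1 :=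
  (LinearMap.coprodEquiv (R := ℝ) (M := A.V) (M₂ := B.V) (M₃ := ℂ) ℂ).symm ≪≫ₗ
    g.prodCongr h ≪≫ₗ LinearMap.coprodEquiv (R := ℝ) (M := A.V) (M₂ := B.V) (M₃ := ℂ) ℂ

section modules

variable (k : Type*) [Field k] [Algebra k ℂ]

variable {A k} in
/-- `V` is a `G(A)_k`-submodule of `H^⋆(A, k)`. Since `G(A)` is reduced, stability of `V` under the
algebraic group `G(A)_k` means stability of `V_ℂ` under the complex points of `G(A)`. -/
def IsHodgeGroupSubmodule (V : Submodule k A.Coh) : Prop :=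
  V ≤ A.totalCohOver k ∧
    ∀ g ∈ A.hodgeGroup, ∀ x ∈ Submodule.span ℂ (V : Set A.Coh),
      act g x ∈ Submodule.span ℂ (V : Set A.Coh)

variable {A k} in
/-- `V` is an irreducible `G(A)_k`-submodule of `H^⋆(A, k)`. -/
def IsIrreducibleHodgeGroupSubmodule (V : Submodule k A.Coh) : Prop :=
  IsHodgeGroupSubmodule V ∧ V ≠ ⊥ ∧
    ∀ U : Submodule k A.Coh, IsHodgeGroupSubmodule U → U ≤ V → U = ⊥ ∨ U = V

variable {A k} {B : ComplexAbelianVariety} in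
/-- The submodules `V` of `H^⋆(A, k)` and `V'` of `H^⋆(B, k)` are isomorphic as
`G(A × B)_k`-modules, where `G(A × B) ⊆ G(A) × G(B)`: there is a `k`-linear isomorphism whose
complexification commutes with the complex points `(g, h)` of `G(A × B)`, `g` acting on `V_ℂ` and
`h` on `V'_ℂ`. -/
def IsomorphicOverProd (V : Submodule k A.Coh) (V' : Submodule k B.Coh) : Prop :=
  ∃ e : V ≃ₗ[k] V', ∀ (g : A.H1 ≃ₗ[ℂ] A.H1) (h : B.H1 ≃ₗ[ℂ] B.H1),
    blockSum g h ∈ (A.prod B).hodgeGroup →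
    ∀ x y : ℂ ⊗[k] V, toComplex V y = act g (toComplex V x) →
      toComplex V' (e.toLinearMap.baseChange ℂ y) =
        act h (toComplex V' (e.toLinearMap.baseChange ℂ x))

/-- `A` is `k`-dominated by the class `𝒜`. -/
def IsDominatedOver (𝒜 : Set ComplexAbelianVariety) : Prop :=
  ∀ V : Submodule k A.Coh, IsIrreducibleHodgeGroupSubmodule V →
    ∃ B ∈ 𝒜, ∃ (n : ℕ) (V' : Submodule k B.Coh),
      V' ≤ B.cohOver k n ∧ IsHodgeGroupSubmodule V' ∧ IsomorphicOverProd V V' ∧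
      ∃ ω ∈ Submodule.span ℂ (V' : Set B.Coh), ω ≠ 0 ∧ ω ∈ B.hodge n 0

end modules

end ComplexAbelianVariety

end

/-!
The circle `{|u| = 1}` acts on `H^{p,q}` through `u ↦ u^{p-q}`, so that in a fixed degree the Hodge
type is read off from the circle, and a map of cohomology spaces that commutes with the circle
respects Hodge types up to a Tate twist. The Hodge group is the rational hull of the circle.

Let `W` be an irreducible Hodge structure in `Hⁿ(A, ℚ)`. The stabilizer of `W_ℂ` is a rational
group containing the circle, so `k W` is a module over the Hodge group and contains an irreducible
one, `V`. The hypothesis gives an isomorphism of `V` with some `V' ⊆ Hⁿ'(B, k)` whose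
complexification contains a nonzero form `ω` of type `(n', 0)`. The conclusion asks for a rational
map from `W`, and two facts produce it.

* Complete reducibility (`exists_equivariant_projection`, `exists_basis_adjoint_mem_hodgeGroup`).
  A Riemann form gives a Hermitian inner product on `H¹(A, ℂ)` for which the Hodge group is stable
  under adjoints: the adjoint of `g` is `C⁻¹ ḡ⁻¹ C`, with `C` the action of `i`. Hence `V_ℂ` is an
  equivariant direct summand of `H^⋆(A, ℂ)`, and `V ≅ V'` extends to a `G(A × B)`-equivariant map
  `Ψ : H^⋆(A, ℂ) → Hⁿ'(B, ℂ)` (`exists_equivariant_extension`).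
* Descent (`exists_rational_equivariant_components`). Write `Ψ = ∑ cᵢ Φᵢ` with `Φᵢ` rational and the
  `cᵢ` linearly independent over `ℚ`. As `G(A × B)` is stable under `Aut ℂ`, all the maps
  `∑ σ(cᵢ) Φᵢ` are equivariant, and Artin's independence of automorphisms, with the fact that the
  fixed field of `Aut ℂ` is `ℚ`, shows that every `Φᵢ` is equivariant.

Since `ω` is in the image of `W_ℂ` under `Ψ`, some `Φᵢ` maps a class of `W_ℂ` of type `(p, q)` with
`p - q = n'` to a nonzero class of type `(n', 0)`. By irreducibility `Φᵢ` embeds `W`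
(`HodgeStructure.IsIrreducible.eq_zero_or_injective`); its image is isomorphic to the Tate twist
`W(q)`, and is fully twisted because of its class of type `(n', 0)`.
-/

noncomputable section
/-! ### Automorphisms of the complex numbers -/

/-- An automorphism of the polynomial ring generated by a transcendence basis of `ℂ / K` extends to
a field automorphism of `ℂ`. -/
theorem Complex.exists_ringEquiv_extending {K ι : Type*} [Field K] [Algebra K ℂ] {v : ι → ℂ}
    (hv : IsTranscendenceBasis K v) (e : MvPolynomial ι K ≃+* MvPolynomial ι K) :
    ∃ σ : ℂ ≃+* ℂ, ∀ p, σ (MvPolynomial.aeval v p) = MvPolynomial.aeval v (e p) := by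
  let _ := IsAlgClosed.isAlgClosure_of_transcendence_basis v hv
  let a := hv.1.aevalEquiv
  let τ : Algebra.adjoin K (Set.range v) ≃+* Algebra.adjoin K (Set.range v) :=
    a.symm.toRingEquiv.trans (e.trans a.toRingEquiv)
  refine ⟨IsAlgClosure.equivOfEquiv ℂ ℂ τ, fun p => ?_⟩
  have h1 : MvPolynomial.aeval v p = algebraMap (Algebra.adjoin K (Set.range v)) ℂ (a p) :=
    (hv.1.algebraMap_aevalEquiv p).symm
  have h2 : MvPolynomial.aeval v (e p) = algebraMap (Algebra.adjoin K (Set.range v)) ℂ (a (e p)) :=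
    (hv.1.algebraMap_aevalEquiv (e p)).symm
  rw [h1, IsAlgClosure.equivOfEquiv_algebraMap, h2]
  simp [τ]

theorem Complex.isAlgebraic_of_forall_ringEquiv {z : ℂ} (hz : ∀ σ : ℂ ≃+* ℂ, σ z = z) :
    IsAlgebraic ℚ z := by
  by_contra htr
  have hind : AlgebraicIndepOn ℚ id ({z} : Set ℂ) := by
    have : AlgebraicIndependent ℚ (fun i : ({z} : Set ℂ) => id i.1) :=
      algebraicIndependent_unique_type_iff.2 htr
    exact this
  obtain ⟨t, hst, ht⟩ := exists_isTranscendenceBasis_superset hind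
  -- The translation of all elements of a transcendence basis by `1` moves `z`.
  let e : MvPolynomial t ℚ ≃ₐ[ℚ] MvPolynomial t ℚ := AlgEquiv.ofAlgHom
    (MvPolynomial.aeval fun i => MvPolynomial.X i + 1)
    (MvPolynomial.aeval fun i => MvPolynomial.X i - 1)
    (by ext; simp) (by ext; simp)
  obtain ⟨σ, hσ⟩ := Complex.exists_ringEquiv_extending ht e.toRingEquiv
  have := hσ (MvPolynomial.X ⟨z, hst rfl⟩)
  simp [e, hz] at this

/-- The fixed field of the group of automorphisms of `ℂ` is `ℚ`. -/
theorem Complex.exists_rat_of_forall_ringEquiv {z : ℂ} (hz : ∀ σ : ℂ ≃+* ℂ, σ z = z) :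
    ∃ q : ℚ, (q : ℂ) = z := by
  have halg := Complex.isAlgebraic_of_forall_ringEquiv hz
  let K := algebraicClosure ℚ ℂ
  have : IsAlgClosure ℚ K := algebraicClosure.isAlgClosure ℚ ℂ
  have : Normal ℚ K := IsAlgClosure.normal ℚ K
  have : IsGalois ℚ K := ⟨⟩
  let z' : K := ⟨z, mem_algebraicClosure_iff.2 halg⟩
  have h : z' ∈ (⊥ : IntermediateField ℚ K) := by
    rw [InfiniteGalois.mem_bot_iff_fixed]
    intro τ
    obtain ⟨ι, v, hv⟩ := exists_isTranscendenceBasis' K ℂ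
    obtain ⟨σ, hσ⟩ := Complex.exists_ringEquiv_extending hv
      (MvPolynomial.mapEquiv ι τ.toRingEquiv)
    have := hσ (MvPolynomial.C z')
    simp only [MvPolynomial.mapEquiv_apply, MvPolynomial.map_C, MvPolynomial.aeval_C] at this
    apply Subtype.ext
    exact this.symm.trans (hz σ)
  obtain ⟨q, hq⟩ := IntermediateField.mem_bot.1 h
  refine ⟨q, ?_⟩
  have := congrArg (Subtype.val) hq
  simpa [z'] using this

/-- Artin's independence: numbers linearly independent over `ℚ` have linearly independent vectors
of conjugates under `Aut ℂ`. -/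
theorem Complex.eq_zero_of_forall_sum_ringEquiv {ι : Type*} [Fintype ι] {c : ι → ℂ}
    (hc : LinearIndependent ℚ c) {y : ι → ℂ}
    (h : ∀ σ : ℂ ≃+* ℂ, ∑ i, σ (c i) * y i = 0) : y = 0 := by
  classical
  let F := FixedPoints.subfield (ℂ ≃+* ℂ) ℂ
  have hF : ∀ a : F, ∃ q : ℚ, (q : ℂ) = a := fun a =>
    Complex.exists_rat_of_forall_ringEquiv fun σ => a.2 σ
  have hcF : LinearIndependent F c := by
    rw [Fintype.linearIndependent_iff] at hc ⊢
    intro g hg i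
    choose q hq using hF
    have := hc (fun i => q (g i)) (by
      rw [← hg]
      refine Finset.sum_congr rfl fun i _ => ?_
      rw [Algebra.smul_def, Algebra.smul_def]
      exact congrArg (· * c i) (hq (g i))) i
    have h2 := hq (g i)
    rw [this] at h2
    exact Subtype.ext (by simpa using h2.symm)
  have hinj := hc.injective
  have h1 : LinearIndepOn F id ((Finset.univ.image c : Finset ℂ) : Set ℂ) := by
    have := hcF.linearIndepOn_id
    rwa [Finset.coe_image, Finset.coe_univ, Set.image_univ]
  have h2 := FixedPoints.linearIndependent_smul_of_linearIndependent (ℂ ≃+* ℂ) ℂ h1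
  have h3 : LinearIndependent ℂ (fun i => MulAction.toFun (ℂ ≃+* ℂ) ℂ (c i)) :=
    h2.comp (fun i => ⟨c i, by simp⟩) fun i j hij => hinj (by simpa using hij)
  rw [Fintype.linearIndependent_iff] at h3
  funext i
  refine h3 y ?_ i
  funext σ
  simpa [mul_comm] using h σ

/-! ### Rational structures on exterior algebras -/

section ExteriorBasis

open ExteriorAlgebra

variable {H : Type*} [AddCommGroup H] [Module ℂ H] {d : ℕ} (b : Module.Basis (Fin d) ℂ H)

theorem Module.Basis.exteriorAlgebra_empty : b.ExteriorAlgebra ∅ = 1 := by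
  rw [ExteriorAlgebra.basis_apply_ofCard b (Finset.card_empty)]
  simp [ιMulti_family, ιMulti_apply]

theorem Module.Basis.exteriorAlgebra_singleton (i : Fin d) :
    b.ExteriorAlgebra {i} = ι ℂ (b i) := by
  rw [ExteriorAlgebra.basis_apply_ofCard b (Finset.card_singleton i)]
  simp only [ιMulti_family, ιMulti_apply, List.ofFn_succ, List.ofFn_zero, List.prod_cons,
    List.prod_nil, mul_one, Function.comp_apply]
  congr 2
  have := Set.powersetCard.mem_range_ofFinEmbEquiv_symm_iff_mem
    (Set.powersetCard.ofCard (Finset.card_singleton i))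
    (Set.powersetCard.ofFinEmbEquiv.symm (Set.powersetCard.ofCard (Finset.card_singleton i)) 0)
  have h := this.1 ⟨0, rfl⟩
  exact Finset.mem_singleton.1 h

theorem Module.Basis.ι_mul_exteriorAlgebra_of_mem {i : Fin d} {s : Finset (Fin d)} (h : i ∈ s) :
    ι ℂ (b i) * b.ExteriorAlgebra s = 0 := by
  rw [← b.exteriorAlgebra_singleton]
  exact ExteriorAlgebra.basis_mul_of_not_disjoint b ⟨{i}, Finset.card_singleton i⟩ ⟨s, rfl⟩
    (by simpa using h)

theorem Module.Basis.ι_mul_exteriorAlgebra_of_notMem {i : Fin d} {s : Finset (Fin d)}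
    (h : i ∉ s) :
    ∃ u : ℤˣ, ι ℂ (b i) * b.ExteriorAlgebra s = u • b.ExteriorAlgebra (insert i s) := by
  rw [← b.exteriorAlgebra_singleton]
  let i' : Set.powersetCard (Fin d) 1 := ⟨{i}, Finset.card_singleton i⟩
  let s' : Set.powersetCard (Fin d) s.card := ⟨s, rfl⟩
  have hd : Disjoint i'.val s'.val := by simpa [i', s'] using h
  have := ExteriorAlgebra.basis_mul_of_disjoint b i' s' hd
  refine ⟨(Set.powersetCard.permOfDisjoint hd).sign, this.trans ?_⟩
  rw [Set.powersetCard.coe_disjUnion, Finset.insert_eq, Finset.disjUnion_eq_union]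

variable (k : Type*) [Field k] [Algebra k ℂ] [Module k H] [IsScalarTower k ℂ H]

/-- The `k`-span of the `n`-fold products of the vectors of a `ℂ`-basis `b` of `H` has the
basic `n`-vectors of `b` as a `k`-basis. -/
theorem Module.Basis.span_ι_pow (n : ℕ) :
    (Submodule.span k (Set.range fun i => ι ℂ (b i))) ^ n =
      Submodule.span k (b.ExteriorAlgebra '' {s | s.card = n}) := by
  induction n with
  | zero =>
    have : b.ExteriorAlgebra '' {s | s.card = 0} = {1} := by
      ext x
      simp [b.exteriorAlgebra_empty]
    rw [pow_zero, this, Submodule.one_eq_span]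
  | succ n ih =>
    rw [pow_succ', ih]
    apply le_antisymm
    · rw [Submodule.span_mul_span, Submodule.span_le]
      rintro _ ⟨_, ⟨i, rfl⟩, _, ⟨s, hs, rfl⟩, rfl⟩
      change ι ℂ (b i) * b.ExteriorAlgebra s ∈ _
      by_cases h : i ∈ s
      · rw [b.ι_mul_exteriorAlgebra_of_mem h]; exact zero_mem _
      · obtain ⟨u, hu⟩ := b.ι_mul_exteriorAlgebra_of_notMem h
        rw [hu, Units.smul_def]
        refine zsmul_mem (Submodule.subset_span (Set.mem_image_of_mem _ ?_)) _
        have hs' : s.card = n := hs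
        change (insert i s).card = n + 1
        rw [Finset.card_insert_of_notMem h, hs']
    · rw [Submodule.span_le]
      rintro _ ⟨s, hs, rfl⟩
      obtain ⟨i, t, hit, rfl, ht⟩ := Finset.card_eq_succ.1 hs
      obtain ⟨u, hu⟩ := b.ι_mul_exteriorAlgebra_of_notMem hit
      have : b.ExteriorAlgebra (insert i t) =
          (u⁻¹ : ℤˣ) • (ι ℂ (b i) * b.ExteriorAlgebra t) := by
        rw [hu, inv_smul_smul]
      have hm : ι ℂ (b i) * b.ExteriorAlgebra t ∈
          Submodule.span k (Set.range fun i => ι ℂ (b i)) *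
            Submodule.span k (b.ExteriorAlgebra '' {s | s.card = n}) :=
        Submodule.mul_mem_mul (Submodule.subset_span (Set.mem_range_self i))
          (Submodule.subset_span (Set.mem_image_of_mem _ ht))
      rw [this, Units.smul_def]
      exact zsmul_mem hm _

/-- The matrix of the automorphism of the exterior algebra induced by `g` has entries which are
polynomials with rational coefficients in the entries of the matrix of `g`. -/
theorem Module.Basis.exists_mvPolynomial_coord_map (s t : Finset (Fin d)) :
    ∃ F : MvPolynomial (Fin d × Fin d) ℚ, ∀ g : H →ₗ[ℂ] H,
      b.ExteriorAlgebra.coord s (ExteriorAlgebra.map g (b.ExteriorAlgebra t)) =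
        MvPolynomial.aeval (fun ij => b.repr (g (b ij.2)) ij.1) F := by
  induction t using Finset.induction_on generalizing s with
  | empty =>
    refine ⟨if s = ∅ then 1 else 0, fun g => ?_⟩
    have h1 : ExteriorAlgebra.map g (b.ExteriorAlgebra ∅) = b.ExteriorAlgebra ∅ := by
      rw [b.exteriorAlgebra_empty, map_one]
    rw [h1, Module.Basis.coord_apply, Module.Basis.repr_self, Finsupp.single_apply]
    by_cases h : s = ∅
    · simp [h]
    · simp [h, Ne.symm h]
  | insert i t hit ih =>
    choose F hF using ih
    obtain ⟨u, hu⟩ := b.ι_mul_exteriorAlgebra_of_notMem hit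
    have h1 : b.ExteriorAlgebra (insert i t) =
        (u⁻¹ : ℤˣ) • (ι ℂ (b i) * b.ExteriorAlgebra t) := by
      rw [hu, inv_smul_smul]
    -- The structure constants of the multiplication are rational.
    have h2 : ∀ (j : Fin d) (r s : Finset (Fin d)), ∃ q : ℚ,
        b.ExteriorAlgebra.coord s (ι ℂ (b j) * b.ExteriorAlgebra r) = q := by
      intro j r s
      by_cases h : j ∈ r
      · exact ⟨0, by simp [b.ι_mul_exteriorAlgebra_of_mem h]⟩
      · obtain ⟨w, hw⟩ := b.ι_mul_exteriorAlgebra_of_notMem h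
        rw [hw, Units.smul_def, map_zsmul, Module.Basis.coord_apply, Module.Basis.repr_self,
          Finsupp.single_apply]
        by_cases h' : insert j r = s
        · exact ⟨(w : ℤ), by simp [h']⟩
        · exact ⟨0, by simp [h']⟩
    choose q hq using h2
    refine ⟨∑ j, ∑ r, ((((u⁻¹ : ℤˣ) : ℤ) : ℚ) * q j r s) •
      (MvPolynomial.X (j, i) * F r), fun g => ?_⟩
    have h3 : g (b i) = ∑ j, b.repr (g (b i)) j • b j :=
      (b.sum_repr (g (b i))).symm
    have h4 : ExteriorAlgebra.map g (b.ExteriorAlgebra t) = ∑ r,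
        MvPolynomial.aeval (fun ij => b.repr (g (b ij.2)) ij.1) (F r) •
          b.ExteriorAlgebra r := by
      conv_lhs => rw [← b.ExteriorAlgebra.sum_repr (ExteriorAlgebra.map g (b.ExteriorAlgebra t))]
      refine Finset.sum_congr rfl fun r _ => ?_
      rw [← hF r g, Module.Basis.coord_apply]
    rw [h1, Units.smul_def, map_zsmul, map_mul, ExteriorAlgebra.map_apply_ι, h3, h4, map_sum,
      Finset.sum_mul_sum]
    simp only [map_sum, map_smul, map_zsmul, map_mul, MvPolynomial.aeval_X, smul_mul_smul_comm, hq,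
      smul_eq_mul, Finset.smul_sum]
    refine Finset.sum_congr rfl fun j _ => Finset.sum_congr rfl fun r _ => ?_
    simp only [zsmul_eq_mul, Rat.smul_def, Rat.cast_mul, Rat.cast_intCast]
    ring

end ExteriorBasis

section Span

variable {M : Type*} [AddCommGroup M] [Module ℂ M] {k : Type*} [Field k] [Algebra k ℂ]
  [Module k M] [IsScalarTower k ℂ M]

/-- A `k`-subspace of the `k`-span of a `ℂ`-basis has linearly disjoint complexification. -/
theorem Submodule.liftBaseChange_subtype_injective {ι : Type*} (β : Module.Basis ι ℂ M)
    {V : Submodule k M} (hV : V ≤ Submodule.span k (Set.range β)) :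
    Function.Injective (V.subtype.liftBaseChange ℂ) := by
  have hli : LinearIndependent k β := β.linearIndependent.restrict_scalars' k
  let γ : Module.Basis ι k (Submodule.span k (Set.range β)) := Module.Basis.span hli
  have h1 : Function.Injective
      ((Submodule.span k (Set.range β)).subtype.liftBaseChange ℂ) := by
    have : (Submodule.span k (Set.range β)).subtype.liftBaseChange ℂ =
        ((γ.baseChange ℂ).equiv β (Equiv.refl ι)).toLinearMap := by
      refine (γ.baseChange ℂ).ext fun i => ?_
      have : γ.baseChange ℂ i = 1 ⊗ₜ[k] γ i := by simp
      rw [LinearEquiv.coe_coe, Module.Basis.equiv_apply, this]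
      simp [γ, Module.Basis.span_apply]
    rw [this]
    exact LinearEquiv.injective _
  have h2 : Function.Injective ((Submodule.inclusion hV).baseChange ℂ) := by
    exact Module.Flat.lTensor_preserves_injective_linearMap _ (Submodule.inclusion_injective hV)
  have h3 : V.subtype.liftBaseChange ℂ =
      ((Submodule.span k (Set.range β)).subtype.liftBaseChange ℂ) ∘ₗ
        ((Submodule.inclusion hV).baseChange ℂ) := by
    ext; simp
  rw [h3]
  exact h1.comp h2

theorem Submodule.range_liftBaseChange_subtype (V : Submodule k M) :
    LinearMap.range (V.subtype.liftBaseChange ℂ) = Submodule.span ℂ (V : Set M) := by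
  apply le_antisymm
  · rintro _ ⟨x, rfl⟩
    induction x with
    | zero => simp
    | tmul c x =>
      simpa using Submodule.smul_mem _ c (Submodule.subset_span x.2)
    | add x y hx hy => rw [map_add]; exact add_mem hx hy
  · rw [Submodule.span_le]
    intro x hx
    exact ⟨1 ⊗ₜ ⟨x, hx⟩, by simp⟩

end Span

/-! ### Lattice bases of cohomology -/

/-- The basis of `Hom_ℝ(V, ℂ)` dual to an `ℝ`-basis of `V`. -/
def complexDualBasis {V : Type*} [AddCommGroup V] [Module ℝ V] {n : ℕ}
    (v : Module.Basis (Fin n) ℝ V) : Module.Basis (Fin n) ℂ (V →ₗ[ℝ] ℂ) :=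
  Module.Basis.ofEquivFun (v.constr ℂ).symm

section complexDualBasis

variable {V : Type*} [AddCommGroup V] [Module ℝ V] {n : ℕ} (v : Module.Basis (Fin n) ℝ V)

@[simp]
theorem complexDualBasis_repr (φ : V →ₗ[ℝ] ℂ) (i : Fin n) :
    (complexDualBasis v).repr φ i = φ (v i) := by
  have h := (v.constr ℂ).apply_symm_apply φ
  conv_rhs => rw [← h, Module.Basis.constr_basis]
  rfl

theorem complexDualBasis_apply (i : Fin n) (x : V) :
    complexDualBasis v i x = (v.repr x i : ℂ) := by
  have h : complexDualBasis v i = v.constr ℂ (Pi.single i 1) := by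
    rw [complexDualBasis, Module.Basis.coe_ofEquivFun]
    rfl
  rw [h, Module.Basis.constr_apply_fintype]
  simp [Pi.single_apply, Module.Basis.equivFun_apply]

theorem complexDualBasis_apply_self (i j : Fin n) :
    complexDualBasis v i (v j) = if i = j then 1 else 0 := by
  rw [complexDualBasis_apply, Module.Basis.repr_self, Finsupp.single_apply]
  simp [eq_comm, apply_ite]

end complexDualBasis

namespace ComplexAbelianVariety

variable (A B : ComplexAbelianVariety)

/-- The rank of the lattice of `A`. -/
def latticeRank : ℕ := A.exists_basis.choose

/-- A basis of the lattice of `A`, as an `ℝ`-basis of `V`. -/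
def latticeBasis : Module.Basis (Fin A.latticeRank) ℝ A.V := A.exists_basis.choose_spec.choose

theorem lattice_eq_span : A.lattice = Submodule.span ℤ (Set.range A.latticeBasis) :=
  A.exists_basis.choose_spec.choose_spec

/-- The basis of `H¹(A, ℂ)` dual to the basis of the lattice. -/
def h1Basis : Module.Basis (Fin A.latticeRank) ℂ A.H1 := complexDualBasis A.latticeBasis

/-- The basis of `H^⋆(A, ℂ)` formed by the products of elements of `h1Basis`. -/
def cohBasis : Module.Basis (Finset (Fin A.latticeRank)) ℂ A.Coh := A.h1Basis.ExteriorAlgebra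

theorem h1Basis_repr (φ : A.H1) (i : Fin A.latticeRank) :
    A.h1Basis.repr φ i = φ (A.latticeBasis i) :=
  complexDualBasis_repr _ _ _

theorem finiteDimensional_coh : FiniteDimensional ℂ A.Coh :=
  Module.Finite.of_basis A.cohBasis

section rational

variable (k : Type*) [Field k] [Algebra k ℂ]

theorem latticeBasis_mem (i : Fin A.latticeRank) : A.latticeBasis i ∈ A.lattice := by
  rw [A.lattice_eq_span]
  exact Submodule.subset_span ⟨i, rfl⟩

theorem h1Basis_mem (i : Fin A.latticeRank) : A.h1Basis i ∈ A.H1Over k := by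
  intro x hx
  rw [A.lattice_eq_span] at hx
  induction hx using Submodule.span_induction with
  | mem x hx =>
    obtain ⟨j, rfl⟩ := hx
    rw [h1Basis, complexDualBasis_apply_self]
    split_ifs
    · exact one_mem _
    · exact zero_mem _
  | zero => rw [map_zero]; exact zero_mem _
  | add x y _ _ hx hy => rw [map_add]; exact add_mem hx hy
  | smul a x _ hx => rw [map_zsmul]; exact zsmul_mem hx a

theorem H1Over_eq_span : A.H1Over k = Submodule.span k (Set.range A.h1Basis) := by
  apply le_antisymm
  · intro φ hφ
    choose c hc using fun i => hφ _ (A.latticeBasis_mem i)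
    have : φ = ∑ i, c i • A.h1Basis i := by
      conv_lhs => rw [← A.h1Basis.sum_repr φ]
      refine Finset.sum_congr rfl fun i _ => ?_
      rw [h1Basis_repr, ← hc, algebraMap_smul]
    rw [this]
    exact sum_mem fun i _ => Submodule.smul_mem _ _ (Submodule.subset_span ⟨i, rfl⟩)
  · rw [Submodule.span_le]
    rintro _ ⟨i, rfl⟩
    exact A.h1Basis_mem k i

theorem cohOver_eq_span (n : ℕ) :
    A.cohOver k n = Submodule.span k (A.cohBasis '' {s | s.card = n}) := by
  rw [cohOver, H1Over_eq_span, Submodule.map_span, cohBasis, ← A.h1Basis.span_ι_pow k n,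
    ← Set.range_comp]
  rfl

theorem totalCohOver_eq_span :
    A.totalCohOver k = Submodule.span k (Set.range A.cohBasis) := by
  simp_rw [totalCohOver, cohOver_eq_span, ← Submodule.span_iUnion, ← Set.image_iUnion]
  congr 1
  rw [← Set.image_univ]
  congr 1
  ext s
  simp

theorem cohOver_le_totalCohOver (n : ℕ) : A.cohOver k n ≤ A.totalCohOver k :=
  le_iSup (A.cohOver k) n

variable {A k} in
theorem toComplex_injective {V : Submodule k A.Coh} (hV : V ≤ A.totalCohOver k) :
    Function.Injective (toComplex V) :=
  Submodule.liftBaseChange_subtype_injective A.cohBasis (hV.trans (A.totalCohOver_eq_span k).le)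

variable {A k} in
theorem range_toComplex (V : Submodule k A.Coh) :
    LinearMap.range (toComplex V) = Submodule.span ℂ (V : Set A.Coh) :=
  Submodule.range_liftBaseChange_subtype V

/-- `Hⁿ(A, ℂ)`. -/
def cohDegree (n : ℕ) : Submodule ℂ A.Coh := LinearMap.range (ExteriorAlgebra.ι ℂ (M := A.H1)) ^ n

theorem cohDegree_eq_span (n : ℕ) :
    A.cohDegree n = Submodule.span ℂ (A.cohBasis '' {s | s.card = n}) := by
  rw [cohBasis, ← A.h1Basis.span_ι_pow ℂ n, cohDegree, LinearMap.range_eq_map, ← A.h1Basis.span_eq,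
    Submodule.map_span, ← Set.range_comp]
  rfl

theorem cohOver_le_cohDegree (n : ℕ) : (A.cohOver k n : Set A.Coh) ⊆ A.cohDegree n := by
  rw [cohOver_eq_span, cohDegree_eq_span]
  exact Submodule.span_subset_span k ℂ _

theorem mem_cohDegree_iff (n : ℕ) (x : A.Coh) :
    x ∈ A.cohDegree n ↔ ∀ s, s.card ≠ n → A.cohBasis.coord s x = 0 := by
  rw [cohDegree_eq_span, A.cohBasis.mem_span_image]
  constructor
  · intro h s hs
    by_contra h'
    exact hs (h (Finsupp.mem_support_iff.2 h'))
  · intro h s hs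
    by_contra h'
    exact Finsupp.mem_support_iff.1 hs (h s h')

end rational

/-! ### The circle and the Galois action -/

/-- The automorphism of `H¹(A, ℂ)` induced by multiplication by `u ≠ 0` on `V`. -/
def scalarAut (u : ℂ) (hu : u ≠ 0) : A.H1 ≃ₗ[ℂ] A.H1 where
  toFun φ :=
    { toFun := fun x => φ (u • x)
      map_add' := fun x y => by rw [smul_add, map_add]
      map_smul' := fun r x => by rw [smul_comm, map_smul, RingHom.id_apply] }
  invFun φ :=
    { toFun := fun x => φ (u⁻¹ • x)
      map_add' := fun x y => by rw [smul_add, map_add]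
      map_smul' := fun r x => by rw [smul_comm, map_smul, RingHom.id_apply] }
  map_add' _ _ := rfl
  map_smul' _ _ := rfl
  left_inv φ := by ext x; simp [smul_smul, hu]
  right_inv φ := by ext x; simp [smul_smul, hu]

@[simp]
theorem scalarAut_apply (u : ℂ) (hu : u ≠ 0) (φ : A.H1) (x : A.V) :
    A.scalarAut u hu φ x = φ (u • x) := rfl

theorem scalarAut_mem_hodgeGroup (u : ℂ) (hu : u ≠ 0) (h1 : ‖u‖ = 1) :
    A.scalarAut u hu ∈ A.hodgeGroup := by
  rw [hodgeGroup, Subgroup.mem_sInf]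
  rintro G ⟨-, hG⟩
  exact hG _ ⟨u, h1, fun _ _ => rfl⟩

variable {A} in
theorem hodgeGroup_le {G : Subgroup (A.H1 ≃ₗ[ℂ] A.H1)} (hG : A.IsRationalAlgebraic G)
    (h : ∀ u hu, ‖u‖ = 1 → A.scalarAut u hu ∈ G) : A.hodgeGroup ≤ G := by
  apply sInf_le
  refine ⟨hG, ?_⟩
  rintro g ⟨u, hu, hg⟩
  have hu0 : u ≠ 0 := by rintro rfl; simp at hu
  have : g = A.scalarAut u hu0 := by
    ext φ x
    exact hg φ x
  rw [this]
  exact h u hu0 hu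

/-- The `σ`-semilinear automorphism of `H¹(A, ℂ) = ℂ ⊗ H¹(A, ℚ)` given by `σ ∈ Aut ℂ`. -/
def galois (σ : ℂ ≃+* ℂ) : A.H1 ≃+ A.H1 :=
  A.h1Basis.equivFun.toAddEquiv.trans
    ((AddEquiv.piCongrRight fun _ => σ.toAddEquiv).trans A.h1Basis.equivFun.symm.toAddEquiv)

theorem galois_apply_latticeBasis (σ : ℂ ≃+* ℂ) (φ : A.H1) (i : Fin A.latticeRank) :
    A.galois σ φ (A.latticeBasis i) = σ (φ (A.latticeBasis i)) := by
  rw [← h1Basis_repr, ← h1Basis_repr]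
  have : A.h1Basis.equivFun (A.galois σ φ) = fun i => σ (A.h1Basis.equivFun φ i) :=
    A.h1Basis.equivFun.apply_symm_apply _
  exact congrFun this i

variable {A} in
theorem h1_ext {φ ψ : A.H1} (h : ∀ i, φ (A.latticeBasis i) = ψ (A.latticeBasis i)) : φ = ψ :=
  A.latticeBasis.ext h

theorem galois_smul (σ : ℂ ≃+* ℂ) (c : ℂ) (φ : A.H1) :
    A.galois σ (c • φ) = σ c • A.galois σ φ := by
  refine h1_ext fun i => ?_
  simp [galois_apply_latticeBasis]

theorem galois_symm_smul (σ : ℂ ≃+* ℂ) (c : ℂ) (φ : A.H1) :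
    (A.galois σ).symm (c • φ) = σ.symm c • (A.galois σ).symm φ := by
  rw [AddEquiv.symm_apply_eq, galois_smul]
  simp

theorem galois_of_mem (σ : ℂ ≃+* ℂ) {φ : A.H1} (hφ : φ ∈ A.H1Over ℚ) : A.galois σ φ = φ := by
  refine h1_ext fun i => ?_
  obtain ⟨q, hq⟩ := hφ _ (A.latticeBasis_mem i)
  rw [galois_apply_latticeBasis, ← hq]
  simp

theorem galois_conj (φ : A.H1) (x : A.V) :
    A.galois (starRingAut : ℂ ≃+* ℂ) φ x = starRingEnd ℂ (φ x) := by
  have : A.galois (starRingAut : ℂ ≃+* ℂ) φ = Complex.conjAe.toLinearMap ∘ₗ φ := by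
    refine h1_ext fun i => ?_
    rw [galois_apply_latticeBasis]
    rfl
  rw [this]
  rfl

/-- The conjugate `σ g σ⁻¹` of an automorphism of `H¹(A, ℂ)` by `σ ∈ Aut ℂ`. -/
def galoisConj (σ : ℂ ≃+* ℂ) (g : A.H1 ≃ₗ[ℂ] A.H1) : A.H1 ≃ₗ[ℂ] A.H1 where
  toFun φ := A.galois σ (g ((A.galois σ).symm φ))
  invFun φ := A.galois σ (g.symm ((A.galois σ).symm φ))
  map_add' _ _ := by simp
  map_smul' c φ := by simp [galois_symm_smul, galois_smul]
  left_inv φ := by simp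
  right_inv φ := by simp

theorem galoisConj_apply (σ : ℂ ≃+* ℂ) (g : A.H1 ≃ₗ[ℂ] A.H1) (φ : A.H1) :
    A.galoisConj σ g φ = A.galois σ (g ((A.galois σ).symm φ)) := rfl

variable {A} in
theorem repr_galoisConj (σ : ℂ ≃+* ℂ) (g : A.H1 ≃ₗ[ℂ] A.H1) {d : ℕ}
    (b : Module.Basis (Fin d) ℂ A.H1) (hb : ∀ i, b i ∈ A.H1Over ℚ) (i j : Fin d) :
    b.repr (A.galoisConj σ g (b j)) i = σ (b.repr (g (b j)) i) := by
  have h1 : (A.galois σ).symm (b j) = b j := by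
    rw [AddEquiv.symm_apply_eq, A.galois_of_mem σ (hb j)]
  have h2 : A.galois σ (g (b j)) = ∑ i, σ (b.repr (g (b j)) i) • b i := by
    conv_lhs => rw [← b.sum_repr (g (b j))]
    rw [map_sum]
    refine Finset.sum_congr rfl fun i _ => ?_
    rw [galois_smul, A.galois_of_mem σ (hb i)]
  rw [galoisConj_apply, h1, h2, b.repr_sum_self]

theorem _root_.MvPolynomial.aeval_ringEquiv {J : Type*} (σ : ℂ ≃+* ℂ) (x : J → ℂ)
    (f : MvPolynomial J ℚ) :
    MvPolynomial.aeval (fun j => σ (x j)) f = σ (MvPolynomial.aeval x f) := by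
  have : MvPolynomial.aeval (fun j => σ (x j)) =
      (σ.toRingHom.toRatAlgHom).comp (MvPolynomial.aeval (R := ℚ) x) := by
    ext j; simp
  rw [this]
  rfl

variable {A} in
/-- Groups defined over `ℚ` are stable under the automorphisms of `ℂ`. -/
theorem IsRationalAlgebraic.galoisConj_mem {G : Subgroup (A.H1 ≃ₗ[ℂ] A.H1)}
    (hG : A.IsRationalAlgebraic G) (σ : ℂ ≃+* ℂ) {g : A.H1 ≃ₗ[ℂ] A.H1} (hg : g ∈ G) :
    A.galoisConj σ g ∈ G := by
  obtain ⟨d, b, P, hb, hP⟩ := hG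
  rw [hP] at hg ⊢
  intro f hf
  have := hg f hf
  simp only [LinearMap.toMatrix_apply, LinearEquiv.coe_coe] at this ⊢
  simp only [repr_galoisConj σ g b hb]
  rw [MvPolynomial.aeval_ringEquiv, this, map_zero]

variable {A} in
theorem galoisConj_mem_hodgeGroup (σ : ℂ ≃+* ℂ) {g : A.H1 ≃ₗ[ℂ] A.H1} (hg : g ∈ A.hodgeGroup) :
    A.galoisConj σ g ∈ A.hodgeGroup := by
  rw [hodgeGroup, Subgroup.mem_sInf] at hg ⊢
  exact fun G hG => hG.1.galoisConj_mem σ (hg G hG)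

end ComplexAbelianVariety

namespace ComplexAbelianVariety

variable {A B : ComplexAbelianVariety}

/-! ### Subgroups defined over the rational numbers -/

theorem act_one : act (1 : A.H1 ≃ₗ[ℂ] A.H1) = LinearMap.id := by
  have : ((1 : A.H1 ≃ₗ[ℂ] A.H1) : A.H1 →ₗ[ℂ] A.H1) = LinearMap.id := rfl
  rw [act, this, ExteriorAlgebra.map_id]
  rfl

theorem act_mul (g h : A.H1 ≃ₗ[ℂ] A.H1) : act (g * h) = act g ∘ₗ act h := by
  have : ((g * h : A.H1 ≃ₗ[ℂ] A.H1) : A.H1 →ₗ[ℂ] A.H1) = g.toLinearMap ∘ₗ h.toLinearMap := rfl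
  rw [act, this, ← ExteriorAlgebra.map_comp_map]
  rfl

theorem act_inv_apply (g : A.H1 ≃ₗ[ℂ] A.H1) (x : A.Coh) : act g⁻¹ (act g x) = x := by
  rw [← LinearMap.comp_apply, ← act_mul, inv_mul_cancel, act_one, LinearMap.id_apply]

theorem act_injective (g : A.H1 ≃ₗ[ℂ] A.H1) : Function.Injective (act g) :=
  Function.LeftInverse.injective (act_inv_apply g)

theorem coord_cohBasis_mem {k : Type*} [Field k] [Algebra k ℂ] {x : A.Coh}
    (hx : x ∈ A.totalCohOver k) (s) : ∃ c : k, algebraMap k ℂ c = A.cohBasis.coord s x := by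
  rw [totalCohOver_eq_span] at hx
  induction hx using Submodule.span_induction with
  | mem x hx =>
    obtain ⟨t, rfl⟩ := hx
    rw [Module.Basis.coord_apply, Module.Basis.repr_self, Finsupp.single_apply]
    by_cases h : t = s
    · exact ⟨1, by simp [h]⟩
    · exact ⟨0, by simp [h]⟩
  | zero => exact ⟨0, by simp⟩
  | add x y _ _ hx hy =>
    obtain ⟨c, hc⟩ := hx
    obtain ⟨d, hd⟩ := hy
    exact ⟨c + d, by simp [hc, hd]⟩
  | smul a x _ hx =>
    obtain ⟨c, hc⟩ := hx
    refine ⟨a * c, ?_⟩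
    rw [← algebraMap_smul ℂ a x, map_smul, ← hc, map_mul, smul_eq_mul]

/-- The entries of the matrix of `g` in the basis of `H¹(A, ℂ)` dual to the lattice basis. -/
def entries (g : A.H1 ≃ₗ[ℂ] A.H1) (ij : Fin A.latticeRank × Fin A.latticeRank) : ℂ :=
  A.h1Basis.repr (g (A.h1Basis ij.2)) ij.1

/-- The matrix coefficients of the action on `H^⋆(A, ℂ)` are polynomials with rational coefficients
in the entries of `g`. -/
theorem exists_mvPolynomial_act (ℓ : A.Coh →ₗ[ℂ] ℂ) (hℓ : ∀ s, ∃ q : ℚ, ℓ (A.cohBasis s) = q)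
    {x : A.Coh} (hx : x ∈ A.totalCohOver ℚ) :
    ∃ F : MvPolynomial (Fin A.latticeRank × Fin A.latticeRank) ℚ, ∀ g : A.H1 ≃ₗ[ℂ] A.H1,
      ℓ (act g x) = MvPolynomial.aeval (entries g) F := by
  choose q hq using hℓ
  choose c hc using fun s => coord_cohBasis_mem (k := ℚ) hx s
  choose F hF using A.h1Basis.exists_mvPolynomial_coord_map
  refine ⟨∑ s, ∑ t, (q s * c t) • F s t, fun g => ?_⟩
  have h1 : x = ∑ t, (c t : ℂ) • A.cohBasis t := by
    conv_lhs => rw [← A.cohBasis.sum_repr x]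
    exact Finset.sum_congr rfl fun t _ => by
      rw [← Module.Basis.coord_apply, ← hc]; rfl
  have h2 : ∀ t, act g (A.cohBasis t) =
      ∑ s, MvPolynomial.aeval (entries g) (F s t) • A.cohBasis s := by
    intro t
    conv_lhs => rw [← A.cohBasis.sum_repr (act g (A.cohBasis t))]
    exact Finset.sum_congr rfl fun s _ => congrArg (· • A.cohBasis s) (hF s t g.toLinearMap)
  conv_lhs => rw [h1]
  simp only [map_sum, map_smul, h2, hq, smul_eq_mul, Finset.mul_sum]
  rw [Finset.sum_comm]
  refine Finset.sum_congr rfl fun s _ => Finset.sum_congr rfl fun t _ => ?_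
  rw [Rat.smul_def, Rat.cast_mul]
  ring

/-- Equations in the entries of the matrices with respect to the lattice basis define rational
groups. -/
theorem isRationalAlgebraic_of_entries {G : Subgroup (A.H1 ≃ₗ[ℂ] A.H1)}
    (P : Set (MvPolynomial (Fin A.latticeRank × Fin A.latticeRank) ℚ))
    (hP : ∀ g, g ∈ G ↔ ∀ f ∈ P, MvPolynomial.aeval (entries g) f = 0) :
    A.IsRationalAlgebraic G := by
  refine ⟨_, A.h1Basis, P, A.h1Basis_mem ℚ, fun g => ?_⟩
  rw [hP]
  simp only [LinearMap.toMatrix_apply, LinearEquiv.coe_coe]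
  rfl

/-- The stabilizer of a subspace of `H^⋆(A, ℂ)`. -/
def cohStabilizer (X : Submodule ℂ A.Coh) : Subgroup (A.H1 ≃ₗ[ℂ] A.H1) where
  carrier := {g | X.map (act g) = X}
  one_mem' := by simp [act_one]
  mul_mem' {g h} hg hh := by
    rw [Set.mem_ofPred_eq] at hg hh ⊢
    rw [act_mul, Submodule.map_comp, hh, hg]
  inv_mem' {g} hg := by
    rw [Set.mem_ofPred_eq] at hg ⊢
    conv_lhs => rw [← hg]
    rw [← Submodule.map_comp, ← act_mul, inv_mul_cancel, act_one, Submodule.map_id]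

theorem mem_cohStabilizer_iff {X : Submodule ℂ A.Coh} {g : A.H1 ≃ₗ[ℂ] A.H1} :
    g ∈ cohStabilizer X ↔ ∀ x ∈ X, act g x ∈ X := by
  have := A.finiteDimensional_coh
  constructor
  · intro h x hx
    have h' : X.map (act g) = X := h
    rw [← h']
    exact ⟨x, hx, rfl⟩
  · intro h
    have h1 : X.map (act g) ≤ X := by
      rintro _ ⟨x, hx, rfl⟩
      exact h x hx
    exact Submodule.eq_of_le_of_finrank_eq h1
      (LinearEquiv.finrank_eq (Submodule.equivMapOfInjective _ (act_injective g) X)).symm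

theorem isRationalAlgebraic_cohStabilizer {W : Submodule ℚ A.Coh} (hW : W ≤ A.totalCohOver ℚ) :
    A.IsRationalAlgebraic (cohStabilizer (Submodule.span ℂ (W : Set A.Coh))) := by
  -- A rational projection `P` with kernel `W_ℂ` gives the equations `P (g w) = 0`, for `w ∈ W`.
  obtain ⟨P, hPq, hPW, hPker⟩ : ∃ P : A.Coh →ₗ[ℂ] A.Coh,
      (∀ s, P (A.cohBasis s) ∈ A.totalCohOver ℚ) ∧ (∀ w ∈ W, P w = 0) ∧
      ∀ x, x - P x ∈ Submodule.span ℂ (W : Set A.Coh) := by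
    let N := A.totalCohOver ℚ
    have hβ : ∀ s, A.cohBasis s ∈ N := fun s => by
      change _ ∈ A.totalCohOver ℚ
      rw [totalCohOver_eq_span]
      exact Submodule.subset_span ⟨s, rfl⟩
    obtain ⟨p, hp⟩ := LinearMap.exists_leftInverse_of_injective (Submodule.inclusion hW)
      (LinearMap.ker_eq_bot.2 (Submodule.inclusion_injective hW))
    let P : A.Coh →ₗ[ℂ] A.Coh :=
      A.cohBasis.constr ℂ fun s => A.cohBasis s - (p ⟨A.cohBasis s, hβ s⟩ : A.Coh)
    have hP : ∀ s, P (A.cohBasis s) = A.cohBasis s - (p ⟨A.cohBasis s, hβ s⟩ : A.Coh) :=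
      fun s => Module.Basis.constr_basis _ _ _ _
    have hPN : ∀ x (hx : x ∈ N), P x = x - (p ⟨x, hx⟩ : A.Coh) := by
      have key : (P.restrictScalars ℚ) ∘ₗ N.subtype = N.subtype - W.subtype ∘ₗ p := by
        have hspan : Submodule.span ℚ (Set.range fun s => (⟨A.cohBasis s, hβ s⟩ : N)) = ⊤ := by
          apply Submodule.map_injective_of_injective N.subtype_injective
          rw [Submodule.map_span, Submodule.map_top, Submodule.range_subtype, ← Set.range_comp]
          exact (A.totalCohOver_eq_span ℚ).symm
        refine LinearMap.ext_on_range hspan fun s => ?_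
        exact hP s
      intro x hx
      exact LinearMap.congr_fun key ⟨x, hx⟩
    refine ⟨P, fun s => ?_, fun w hw => ?_, fun x => ?_⟩
    · rw [hP]
      exact sub_mem (hβ s) (hW (p _).2)
    · rw [hPN w (hW hw), sub_eq_zero]
      exact (congrArg Subtype.val (LinearMap.congr_fun hp ⟨w, hw⟩)).symm
    · have : x - P x = ∑ s, A.cohBasis.repr x s • (p ⟨A.cohBasis s, hβ s⟩ : A.Coh) := by
        conv_lhs => rw [← A.cohBasis.sum_repr x]
        rw [map_sum, ← Finset.sum_sub_distrib]
        refine Finset.sum_congr rfl fun s _ => ?_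
        rw [map_smul, hP, smul_sub, sub_sub_cancel]
      rw [this]
      exact sum_mem fun s _ => Submodule.smul_mem _ _ (Submodule.subset_span (p _).2)
  have hPspan : ∀ x ∈ Submodule.span ℂ (W : Set A.Coh), P x = 0 := by
    intro x hx
    have : Submodule.span ℂ (W : Set A.Coh) ≤ LinearMap.ker P :=
      Submodule.span_le.2 fun w hw => hPW w hw
    exact this hx
  have hPiff : ∀ x, x ∈ Submodule.span ℂ (W : Set A.Coh) ↔ P x = 0 :=
    fun x => ⟨hPspan x, fun h => by simpa [h] using hPker x⟩
  refine isRationalAlgebraic_of_entries {f | ∃ w ∈ W, ∃ t, ∀ g : A.H1 ≃ₗ[ℂ] A.H1,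
    A.cohBasis.coord t (P (act g w)) = MvPolynomial.aeval (entries g) f} fun g => ?_
  rw [mem_cohStabilizer_iff]
  constructor
  · rintro h f ⟨w, hw, t, hf⟩
    rw [← hf, hPspan _ (h w (Submodule.subset_span hw)), map_zero]
  · intro h
    have hW' : ∀ w ∈ W, act g w ∈ Submodule.span ℂ (W : Set A.Coh) := by
      intro w hw
      rw [hPiff]
      refine A.cohBasis.ext_elem fun t => ?_
      obtain ⟨f, hf⟩ := exists_mvPolynomial_act (A.cohBasis.coord t ∘ₗ P) (fun s => by
        obtain ⟨c, hc⟩ := coord_cohBasis_mem (hPq s) t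
        exact ⟨c, hc.symm⟩) (hW hw)
      have h1 := h f ⟨w, hw, t, hf⟩
      rw [← hf] at h1
      rw [map_zero, Finsupp.zero_apply]
      exact h1
    intro x hx
    have : Submodule.span ℂ (W : Set A.Coh) ≤
        (Submodule.span ℂ (W : Set A.Coh)).comap (act g) := Submodule.span_le.2 hW'
    exact this hx

/-! ### The Hodge group of a product -/

variable (A B) in
/-- `H¹(A × B, ℂ) = H¹(A, ℂ) ⊕ H¹(B, ℂ)`. -/
def h1ProdEquiv : (A.H1 × B.H1) ≃ₗ[ℂ] (A.prod B).H1 :=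
  LinearMap.coprodEquiv (R := ℝ) (M := A.V) (M₂ := B.V) (M₃ := ℂ) ℂ

theorem h1ProdEquiv_apply (φ : A.H1 × B.H1) (x : A.V) (y : B.V) :
    h1ProdEquiv A B φ (show (A.prod B).V from (x, y)) = φ.1 x + φ.2 y := rfl

theorem blockSum_h1ProdEquiv (g : A.H1 ≃ₗ[ℂ] A.H1) (h : B.H1 ≃ₗ[ℂ] B.H1) (φ : A.H1 × B.H1) :
    blockSum g h (h1ProdEquiv A B φ) = h1ProdEquiv A B (g φ.1, h φ.2) := by
  have : (h1ProdEquiv A B).symm (h1ProdEquiv A B φ) = φ := LinearEquiv.symm_apply_apply _ _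
  change h1ProdEquiv A B (g.prodCongr h ((h1ProdEquiv A B).symm (h1ProdEquiv A B φ))) = _
  rw [this]
  rfl

theorem eq_blockSum_iff (γ : (A.prod B).H1 ≃ₗ[ℂ] (A.prod B).H1) (g : A.H1 ≃ₗ[ℂ] A.H1)
    (h : B.H1 ≃ₗ[ℂ] B.H1) :
    γ = blockSum g h ↔ ∀ φ, γ (h1ProdEquiv A B φ) = h1ProdEquiv A B (g φ.1, h φ.2) := by
  constructor
  · rintro rfl φ
    exact blockSum_h1ProdEquiv g h φ
  · intro H
    refine LinearEquiv.ext fun ψ => ?_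
    obtain ⟨φ, rfl⟩ := (h1ProdEquiv A B).surjective ψ
    rw [H, blockSum_h1ProdEquiv]

variable (A B) in
/-- The embedding `GL(H¹(A)) × GL(H¹(B)) → GL(H¹(A × B))`. -/
def blockSumHom : (A.H1 ≃ₗ[ℂ] A.H1) × (B.H1 ≃ₗ[ℂ] B.H1) →*
    ((A.prod B).H1 ≃ₗ[ℂ] (A.prod B).H1) where
  toFun gh := blockSum gh.1 gh.2
  map_one' := ((eq_blockSum_iff _ _ _).2 fun _ => rfl).symm
  map_mul' g h := by
    refine ((eq_blockSum_iff _ _ _).2 fun φ => ?_).symm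
    rw [LinearEquiv.mul_apply, blockSum_h1ProdEquiv, blockSum_h1ProdEquiv]
    rfl

theorem scalarAut_prod (u : ℂ) (hu : u ≠ 0) :
    (A.prod B).scalarAut u hu = blockSum (A.scalarAut u hu) (B.scalarAut u hu) :=
  (eq_blockSum_iff _ _ _).2 fun _ => rfl

/-- The basis of `H¹(A × B)` formed by bases of `H¹(A)` and `H¹(B)`. -/
def h1ProdBasis {d e : ℕ} (b : Module.Basis (Fin d) ℂ A.H1) (c : Module.Basis (Fin e) ℂ B.H1) :
    Module.Basis (Fin (d + e)) ℂ (A.prod B).H1 :=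
  ((b.prod c).map (h1ProdEquiv A B)).reindex finSumFinEquiv

section h1ProdBasis

variable {d e : ℕ} (b : Module.Basis (Fin d) ℂ A.H1) (c : Module.Basis (Fin e) ℂ B.H1)

theorem h1ProdBasis_inl (i : Fin d) :
    h1ProdBasis b c (finSumFinEquiv (Sum.inl i)) = h1ProdEquiv A B (b i, 0) := by
  rw [h1ProdBasis, Module.Basis.reindex_apply, Equiv.symm_apply_apply, Module.Basis.map_apply]
  congr 1
  ext <;> simp

theorem h1ProdBasis_inr (i : Fin e) :
    h1ProdBasis b c (finSumFinEquiv (Sum.inr i)) = h1ProdEquiv A B (0, c i) := by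
  rw [h1ProdBasis, Module.Basis.reindex_apply, Equiv.symm_apply_apply, Module.Basis.map_apply]
  congr 1
  ext <;> simp

theorem h1ProdBasis_repr_inl (φ : A.H1 × B.H1) (i : Fin d) :
    (h1ProdBasis b c).repr (h1ProdEquiv A B φ) (finSumFinEquiv (Sum.inl i)) =
      b.repr φ.1 i := by
  rw [h1ProdBasis, Module.Basis.repr_reindex_apply, Equiv.symm_apply_apply,
    Module.Basis.map_repr, LinearEquiv.trans_apply, LinearEquiv.symm_apply_apply]
  simp

theorem h1ProdBasis_repr_inr (φ : A.H1 × B.H1) (i : Fin e) :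
    (h1ProdBasis b c).repr (h1ProdEquiv A B φ) (finSumFinEquiv (Sum.inr i)) =
      c.repr φ.2 i := by
  rw [h1ProdBasis, Module.Basis.repr_reindex_apply, Equiv.symm_apply_apply,
    Module.Basis.map_repr, LinearEquiv.trans_apply, LinearEquiv.symm_apply_apply]
  simp

theorem h1ProdBasis_mem (hb : ∀ i, b i ∈ A.H1Over ℚ) (hc : ∀ i, c i ∈ B.H1Over ℚ)
    (i : Fin (d + e)) : h1ProdBasis b c i ∈ (A.prod B).H1Over ℚ := by
  obtain ⟨i | i, rfl⟩ := finSumFinEquiv.surjective i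
  · rw [h1ProdBasis_inl]
    rintro x hx
    obtain ⟨x, y⟩ := x
    have : h1ProdEquiv A B (b i, 0) (show (A.prod B).V from (x, y)) = b i x := by
      rw [h1ProdEquiv_apply]; simp
    exact this ▸ hb i x hx.1
  · rw [h1ProdBasis_inr]
    rintro x hx
    obtain ⟨x, y⟩ := x
    have : h1ProdEquiv A B (0, c i) (show (A.prod B).V from (x, y)) = c i y := by
      rw [h1ProdEquiv_apply]; simp
    exact this ▸ hc i y hx.2

/-- The automorphisms of `H¹(A × B)` with off-diagonal blocks zero are the block sums. -/
theorem exists_blockSum_of_repr_eq_zero (γ : (A.prod B).H1 ≃ₗ[ℂ] (A.prod B).H1)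
    (h1 : ∀ i j, (h1ProdBasis b c).repr (γ (h1ProdBasis b c (finSumFinEquiv (Sum.inr j))))
      (finSumFinEquiv (Sum.inl i)) = 0)
    (h2 : ∀ i j, (h1ProdBasis b c).repr (γ (h1ProdBasis b c (finSumFinEquiv (Sum.inl j))))
      (finSumFinEquiv (Sum.inr i)) = 0) :
    ∃ g h, γ = blockSum g h := by
  have := Module.Finite.of_basis b
  have := Module.Finite.of_basis c
  let γ' : (A.H1 × B.H1) ≃ₗ[ℂ] (A.H1 × B.H1) :=
    (h1ProdEquiv A B).trans (γ.trans (h1ProdEquiv A B).symm)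
  have hγ' : ∀ φ, h1ProdEquiv A B (γ' φ) = γ (h1ProdEquiv A B φ) := fun φ =>
    LinearEquiv.apply_symm_apply (h1ProdEquiv A B) _
  have hl : ∀ φ, (γ' (φ, 0)).2 = 0 := by
    have : LinearMap.snd ℂ A.H1 B.H1 ∘ₗ γ'.toLinearMap ∘ₗ LinearMap.inl ℂ A.H1 B.H1 = 0 := by
      refine b.ext fun j => c.ext_elem fun i => ?_
      have := h2 i j
      rw [h1ProdBasis_inl, ← hγ', h1ProdBasis_repr_inr] at this
      simpa using this
    exact LinearMap.congr_fun this
  have hr : ∀ ψ, (γ' (0, ψ)).1 = 0 := by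
    have : LinearMap.fst ℂ A.H1 B.H1 ∘ₗ γ'.toLinearMap ∘ₗ LinearMap.inr ℂ A.H1 B.H1 = 0 := by
      refine c.ext fun j => b.ext_elem fun i => ?_
      have := h1 i j
      rw [h1ProdBasis_inr, ← hγ', h1ProdBasis_repr_inl] at this
      simpa using this
    exact LinearMap.congr_fun this
  let g := LinearEquiv.ofInjectiveEndo
    (LinearMap.fst ℂ A.H1 B.H1 ∘ₗ γ'.toLinearMap ∘ₗ LinearMap.inl ℂ A.H1 B.H1) (by
      rw [← LinearMap.ker_eq_bot, LinearMap.ker_eq_bot']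
      intro φ hφ
      have : γ' (φ, 0) = 0 := Prod.ext hφ (hl φ)
      exact congrArg Prod.fst ((map_eq_zero_iff γ' γ'.injective).1 this))
  let h := LinearEquiv.ofInjectiveEndo
    (LinearMap.snd ℂ A.H1 B.H1 ∘ₗ γ'.toLinearMap ∘ₗ LinearMap.inr ℂ A.H1 B.H1) (by
      rw [← LinearMap.ker_eq_bot, LinearMap.ker_eq_bot']
      intro φ hφ
      have : γ' (0, φ) = 0 := Prod.ext (hr φ) hφ
      exact congrArg Prod.snd ((map_eq_zero_iff γ' γ'.injective).1 this))
  refine ⟨g, h, (eq_blockSum_iff _ _ _).2 fun φ => ?_⟩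
  rw [← hγ']
  congr 1
  have : φ = (φ.1, 0) + (0, φ.2) := by ext <;> simp
  rw [this, map_add]
  have hg : g φ.1 = (γ' (φ.1, 0)).1 := rfl
  have hh : h φ.2 = (γ' (0, φ.2)).2 := rfl
  ext : 1
  · simp [hr, hg]
  · simp [hl, hh]

end h1ProdBasis

/-- `G(A × B) ⊆ G(A) × G(B)`; the assertion on the first factor. -/
theorem mem_hodgeGroup_of_blockSum_mem {g : A.H1 ≃ₗ[ℂ] A.H1} {h : B.H1 ≃ₗ[ℂ] B.H1}
    (hgh : blockSum g h ∈ (A.prod B).hodgeGroup) : g ∈ A.hodgeGroup := by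
  have hinj : ∀ {g g' : A.H1 ≃ₗ[ℂ] A.H1} {h h' : B.H1 ≃ₗ[ℂ] B.H1},
      blockSum g h = blockSum g' h' → g = g' := by
    intro g g' h h' H
    refine LinearEquiv.ext fun φ => ?_
    have := LinearEquiv.congr_fun H (h1ProdEquiv A B (φ, 0))
    rw [blockSum_h1ProdEquiv, blockSum_h1ProdEquiv] at this
    exact congrArg Prod.fst ((h1ProdEquiv A B).injective this)
  rw [hodgeGroup, Subgroup.mem_sInf]
  rintro G ⟨⟨d, b, P, hb, hP⟩, hcirc⟩
  let G' : Subgroup ((A.prod B).H1 ≃ₗ[ℂ] (A.prod B).H1) :=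
    (G.prod ⊤).map (blockSumHom A B)
  have hmem : ∀ γ, γ ∈ G' ↔ ∃ g ∈ G, ∃ h, γ = blockSum g h := by
    intro γ
    constructor
    · rintro ⟨gh, hgh, rfl⟩
      exact ⟨gh.1, hgh.1, gh.2, rfl⟩
    · rintro ⟨g, hg, h, rfl⟩
      exact ⟨(g, h), ⟨hg, trivial⟩, rfl⟩
  have hG' : (A.prod B).hodgeGroup ≤ G' := by
    refine hodgeGroup_le ?_ fun u hu h1 => ?_
    · let l : Fin d → Fin (d + B.latticeRank) := fun i => finSumFinEquiv (Sum.inl i)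
      let r : Fin B.latticeRank → Fin (d + B.latticeRank) := fun i => finSumFinEquiv (Sum.inr i)
      refine ⟨_, h1ProdBasis b B.h1Basis,
        {f | ∃ i j, f = MvPolynomial.X (l i, r j)} ∪ {f | ∃ i j, f = MvPolynomial.X (r i, l j)} ∪
        (MvPolynomial.rename (Prod.map l l)) '' P,
        h1ProdBasis_mem b B.h1Basis hb (B.h1Basis_mem ℚ), fun γ => ?_⟩
      rw [hmem]
      simp only [LinearMap.toMatrix_apply, LinearEquiv.coe_coe] at hP ⊢
      have key : ∀ (g : A.H1 ≃ₗ[ℂ] A.H1) (h : B.H1 ≃ₗ[ℂ] B.H1) (f : MvPolynomial _ ℚ),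
          MvPolynomial.aeval (fun ij : Fin (d + B.latticeRank) × Fin (d + B.latticeRank) =>
            (h1ProdBasis b B.h1Basis).repr
            (blockSum g h (h1ProdBasis b B.h1Basis ij.2)) ij.1)
            (MvPolynomial.rename (Prod.map l l) f) =
          MvPolynomial.aeval (fun ij : Fin d × Fin d => b.repr (g (b ij.2)) ij.1) f := by
        intro g h f
        rw [MvPolynomial.aeval_rename]
        congr 2
        funext ij
        simp only [Function.comp_apply, Prod.map, l]
        rw [h1ProdBasis_inl, blockSum_h1ProdEquiv, h1ProdBasis_repr_inl]
      constructor
      · rintro ⟨g, hg, h, rfl⟩ f ((⟨i, j, rfl⟩ | ⟨i, j, rfl⟩) | ⟨f, hf, rfl⟩)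
        · rw [MvPolynomial.aeval_X]
          simp only [l, r]
          rw [h1ProdBasis_inr, blockSum_h1ProdEquiv, h1ProdBasis_repr_inl]
          simp
        · rw [MvPolynomial.aeval_X]
          simp only [l, r]
          rw [h1ProdBasis_inl, blockSum_h1ProdEquiv, h1ProdBasis_repr_inr]
          simp
        · rw [key]
          exact (hP g).1 hg f hf
      · intro H
        obtain ⟨g, h, rfl⟩ := exists_blockSum_of_repr_eq_zero b B.h1Basis γ
          (fun i j => by simpa [l, r] using H _ (Or.inl (Or.inl ⟨i, j, rfl⟩)))
          (fun i j => by simpa [l, r] using H _ (Or.inl (Or.inr ⟨i, j, rfl⟩)))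
        refine ⟨g, (hP g).2 fun f hf => ?_, h, rfl⟩
        rw [← key g h]
        exact H _ (Or.inr ⟨f, hf, rfl⟩)
    · exact (hmem _).2 ⟨A.scalarAut u hu, hcirc _ ⟨u, h1, fun _ _ => rfl⟩, _,
        scalarAut_prod u hu⟩
  obtain ⟨g', hg', h', H⟩ := (hmem _).1 (hG' hgh)
  rwa [hinj H]

end ComplexAbelianVariety

/-! ### Complete reducibility of exterior powers -/

section CompleteReducibility

open ExteriorAlgebra

variable {H : Type*} [AddCommGroup H] [Module ℂ H] {d : ℕ} (o : Module.Basis (Fin d) ℂ H)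

/-- The `n`-th tensor power of `g` as a matrix indexed by words of length `n`. -/
def tensorPowerMatrix (n : ℕ) (g : H →ₗ[ℂ] H) : Matrix (Fin n → Fin d) (Fin n → Fin d) ℂ :=
  Matrix.of fun I J => ∏ j, o.repr (g (o (J j))) (I j)

/-- The projection from the `n`-th tensor power of `H`, in coordinates, to the exterior algebra. -/
def wordsToExterior (n : ℕ) : EuclideanSpace ℂ (Fin n → Fin d) →ₗ[ℂ] ExteriorAlgebra ℂ H where
  toFun x := ∑ I, x I • ιMulti ℂ n (o ∘ I)
  map_add' x y := by simp [add_smul, Finset.sum_add_distrib]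
  map_smul' c x := by simp [mul_smul, Finset.smul_sum]

theorem wordsToExterior_apply (n : ℕ) (x : EuclideanSpace ℂ (Fin n → Fin d)) :
    wordsToExterior o n x = ∑ I, x I • ιMulti ℂ n (o ∘ I) := rfl

theorem ιMulti_comp_linearMap (n : ℕ) (g : H →ₗ[ℂ] H) (J : Fin n → Fin d) :
    ιMulti ℂ n (g ∘ o ∘ J) = ∑ I, tensorPowerMatrix o n g I J • ιMulti ℂ n (o ∘ I) := by
  have h1 : (g ∘ o ∘ J) = fun j => ∑ i, o.repr (g (o (J j))) i • o i := by
    funext j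
    exact (o.sum_repr _).symm
  rw [h1]
  have := (ιMulti ℂ n (M := H)).toMultilinearMap.map_sum
    (fun j i => o.repr (g (o (J j))) i • o i)
  refine this.trans (Finset.sum_congr rfl fun I _ => ?_)
  exact (ιMulti ℂ n (M := H)).toMultilinearMap.map_smul_univ _ _

theorem map_wordsToExterior (n : ℕ) (g : H →ₗ[ℂ] H) (x : EuclideanSpace ℂ (Fin n → Fin d)) :
    ExteriorAlgebra.map g (wordsToExterior o n x) =
      wordsToExterior o n (Matrix.toEuclideanLin (tensorPowerMatrix o n g) x) := by
  rw [wordsToExterior_apply, wordsToExterior_apply, map_sum]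
  simp only [map_smul, map_apply_ιMulti, ιMulti_comp_linearMap, Finset.smul_sum, smul_smul]
  rw [Finset.sum_comm]
  refine Finset.sum_congr rfl fun I _ => ?_
  rw [← Finset.sum_smul]
  congr 1
  rw [Matrix.toLpLin_apply]
  simp [Matrix.mulVec, dotProduct, mul_comm]

theorem range_wordsToExterior (n : ℕ) :
    LinearMap.range (wordsToExterior o n) = LinearMap.range (ι ℂ (M := H)) ^ n := by
  have h : LinearMap.range (ι ℂ (M := H)) ^ n =
      Submodule.span ℂ (o.ExteriorAlgebra '' {s | s.card = n}) := by
    rw [← o.span_ι_pow ℂ n, LinearMap.range_eq_map, ← o.span_eq, Submodule.map_span,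
      ← Set.range_comp]
    rfl
  apply le_antisymm
  · rintro _ ⟨x, rfl⟩
    exact sum_mem fun I _ => Submodule.smul_mem _ _ (ιMulti_range ℂ n ⟨_, rfl⟩)
  · rw [h, Submodule.span_le]
    rintro _ ⟨s, hs, rfl⟩
    refine ⟨EuclideanSpace.single (Set.powersetCard.ofFinEmbEquiv.symm
      (Set.powersetCard.ofCard hs)) 1, ?_⟩
    rw [wordsToExterior_apply, ExteriorAlgebra.basis_apply_ofCard o hs]
    simp [ιMulti_family]

/-- The projection to the component of degree `n` of the exterior algebra. -/
theorem exists_projection_degree (n : ℕ) :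
    ∃ δ : ExteriorAlgebra ℂ H →ₗ[ℂ] ExteriorAlgebra ℂ H,
      (∀ x, δ x ∈ LinearMap.range (ι ℂ (M := H)) ^ n) ∧
      (∀ x ∈ LinearMap.range (ι ℂ (M := H)) ^ n, δ x = x) ∧
      ∀ (g : H →ₗ[ℂ] H) x, δ (ExteriorAlgebra.map g x) = ExteriorAlgebra.map g (δ x) := by
  let 𝒜 : ℕ → Submodule ℂ (ExteriorAlgebra ℂ H) := fun n => ⋀[ℂ]^n H
  have hg : ∀ (g : H →ₗ[ℂ] H) (i : ℕ) x, x ∈ 𝒜 i → ExteriorAlgebra.map g x ∈ 𝒜 i := by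
    intro g i x hx
    have h1 : (𝒜 i).map (ExteriorAlgebra.map g).toLinearMap ≤ 𝒜 i := by
      change (LinearMap.range (ι ℂ) ^ i).map _ ≤ LinearMap.range (ι ℂ) ^ i
      rw [Submodule.map_pow]
      apply pow_le_pow_left'
      rintro _ ⟨_, ⟨φ, rfl⟩, rfl⟩
      exact ⟨g φ, by simp⟩
    exact h1 ⟨x, hx, rfl⟩
  refine ⟨GradedAlgebra.proj 𝒜 n, fun x => ?_, fun x hx => ?_, fun g x => ?_⟩
  · rw [GradedAlgebra.proj_apply]
    exact (DirectSum.decompose 𝒜 x n).2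
  · rw [GradedAlgebra.proj_apply]
    exact DirectSum.decompose_of_mem_same 𝒜 hx
  · induction x using DirectSum.Decomposition.inductionOn 𝒜 with
    | zero => simp
    | @homogeneous i x =>
      rw [GradedAlgebra.proj_apply, GradedAlgebra.proj_apply]
      by_cases h : i = n
      · subst h
        rw [DirectSum.decompose_of_mem_same 𝒜 x.2,
          DirectSum.decompose_of_mem_same 𝒜 (hg g _ _ x.2)]
      · rw [DirectSum.decompose_of_mem_ne 𝒜 x.2 h,
          DirectSum.decompose_of_mem_ne 𝒜 (hg g _ _ x.2) h, map_zero]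
    | add x y hx hy => simp only [map_add, hx, hy]

theorem exists_equivariant_projection (Γ : Set (H ≃ₗ[ℂ] H))
    (hΓ : ∀ g ∈ Γ, ∃ g' ∈ Γ, ∀ i j, o.repr (g' (o j)) i = starRingEnd ℂ (o.repr (g (o i)) j))
    (n : ℕ) (V : Submodule ℂ (ExteriorAlgebra ℂ H))
    (hVn : V ≤ LinearMap.range (ι ℂ (M := H)) ^ n)
    (hV : ∀ g ∈ Γ, ∀ x ∈ V, ExteriorAlgebra.map g.toLinearMap x ∈ V) :
    ∃ P : ExteriorAlgebra ℂ H →ₗ[ℂ] ExteriorAlgebra ℂ H,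
      (∀ x, P x ∈ V) ∧ (∀ x ∈ V, P x = x) ∧
      ∀ g ∈ Γ, ∀ x, P (ExteriorAlgebra.map g.toLinearMap x) =
        ExteriorAlgebra.map g.toLinearMap (P x) := by
  let π := wordsToExterior o n
  let T : (H ≃ₗ[ℂ] H) → EuclideanSpace ℂ (Fin n → Fin d) →ₗ[ℂ] EuclideanSpace ℂ (Fin n → Fin d) :=
    fun g => Matrix.toEuclideanLin (tensorPowerMatrix o n g.toLinearMap)
  have hπT : ∀ g x, ExteriorAlgebra.map g.toLinearMap (π x) = π (T g x) := fun g x =>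
    map_wordsToExterior o n g.toLinearMap x
  have hadj : ∀ g ∈ Γ, ∃ g' ∈ Γ, ∀ x y, inner ℂ (T g' x) y = inner ℂ x (T g y) := by
    intro g hg
    obtain ⟨g', hg', h⟩ := hΓ g hg
    refine ⟨g', hg', fun x y => ?_⟩
    have h1 : tensorPowerMatrix o n g'.toLinearMap =
        (tensorPowerMatrix o n g.toLinearMap).conjTranspose := by
      ext I J
      simp [tensorPowerMatrix, h]
    have h2 : T g' = LinearMap.adjoint (T g) := by
      simp only [T]
      rw [h1, Matrix.toEuclideanLin_conjTranspose_eq_adjoint]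
    rw [h2, LinearMap.adjoint_inner_left]
  -- The inverse image of `V` and its orthogonal complement are both stable.
  let U := V.comap π
  have hU : ∀ g ∈ Γ, ∀ x ∈ U, T g x ∈ U := by
    intro g hg x hx
    change π (T g x) ∈ V
    rw [← hπT]
    exact hV g hg _ hx
  have hU' : ∀ g ∈ Γ, ∀ x ∈ Uᗮ, T g x ∈ Uᗮ := by
    intro g hg x hx
    obtain ⟨g', hg', h⟩ := hadj g hg
    rw [Submodule.mem_orthogonal] at hx ⊢
    intro u hu
    rw [← h]
    exact hx _ (hU g' hg' u hu)
  let Q : EuclideanSpace ℂ (Fin n → Fin d) →ₗ[ℂ] EuclideanSpace ℂ (Fin n → Fin d) :=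
    U.starProjection.toLinearMap
  have hQU : ∀ x, Q x ∈ U := fun x => U.starProjection_apply_mem x
  have hQ1 : ∀ x ∈ U, Q x = x := fun x hx => Submodule.starProjection_eq_self_iff.2 hx
  have hQT : ∀ g ∈ Γ, ∀ x, Q (T g x) = T g (Q x) := by
    intro g hg x
    refine Submodule.eq_starProjection_of_mem_orthogonal (hU g hg _ (hQU x)) ?_
    rw [← map_sub]
    exact hU' g hg _ (U.sub_starProjection_mem_orthogonal x)
  obtain ⟨δ, hδn, hδ1, hδg⟩ := exists_projection_degree (H := H) n
  obtain ⟨s, hs⟩ := π.rangeRestrict.exists_rightInverse_of_surjective π.range_rangeRestrict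
  have hs' : ∀ x, π (s x) = x := fun x =>
    congrArg Subtype.val (LinearMap.congr_fun hs x)
  have hrange : LinearMap.range π = LinearMap.range (ι ℂ (M := H)) ^ n :=
    range_wordsToExterior o n
  let δ' : ExteriorAlgebra ℂ H →ₗ[ℂ] LinearMap.range π :=
    δ.codRestrict _ fun x => by rw [hrange]; exact hδn x
  have key : ∀ x y, π x = π y → π (Q x) = π (Q y) := by
    intro x y hxy
    have h1 : x - y ∈ U := by
      change π (x - y) ∈ V
      rw [map_sub, hxy, sub_self]
      exact zero_mem _
    have h2 := hQ1 _ h1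
    rw [← sub_eq_zero, ← map_sub, ← map_sub, h2, map_sub, hxy, sub_self]
  refine ⟨π ∘ₗ Q ∘ₗ s ∘ₗ δ', fun x => hQU _, fun x hx => ?_, fun g hg x => ?_⟩
  · have h1 : π (s (δ' x)) = x := (hs' _).trans (hδ1 x (hVn hx))
    have h2 : s (δ' x) ∈ U := by
      change π (s (δ' x)) ∈ V
      rwa [h1]
    change π (Q (s (δ' x))) = x
    rw [hQ1 _ h2, h1]
  · change π (Q (s (δ' _))) = ExteriorAlgebra.map g.toLinearMap (π (Q (s (δ' x))))
    rw [hπT, ← hQT g hg]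
    apply key
    rw [hs', ← hπT, hs']
    exact hδg _ _

end CompleteReducibility

/-! ### The polarization and the Cartan involution of the Hodge group -/

theorem exists_basis_orthonormal_of_posDef {V : Type*} [AddCommGroup V] [Module ℝ V]
    [FiniteDimensional ℝ V] (S : V →ₗ[ℝ] V →ₗ[ℝ] ℝ) (hsymm : ∀ x y, S x y = S y x)
    (hpos : ∀ x, x ≠ 0 → 0 < S x x) :
    ∃ (n : ℕ) (w : Module.Basis (Fin n) ℝ V), ∀ i j, S (w i) (w j) = if i = j then 1 else 0 := by
  let core : InnerProductSpace.Core ℝ V :=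
    { inner := fun x y => S x y
      conj_inner_symm := fun x y => by simpa using hsymm y x
      re_inner_nonneg := fun x => by
        by_cases h : x = 0
        · simp [h]
        · simpa using (hpos x h).le
      add_left := fun x y z => by simp
      smul_left := fun x y r => by simp
      definite := fun x h => by
        by_contra h'
        exact (hpos x h').ne' h }
  let _ : NormedAddCommGroup V := core.toNormedAddCommGroup
  let _ : InnerProductSpace ℝ V := InnerProductSpace.ofCore core.toCore
  let w := stdOrthonormalBasis ℝ V
  refine ⟨_, w.toBasis, fun i j => ?_⟩
  have := orthonormal_iff_ite.1 w.orthonormal i j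
  rw [w.coe_toBasis]
  exact this

namespace ComplexAbelianVariety

variable {A : ComplexAbelianVariety}

theorem complex_smul_eq (u : ℂ) (x : A.V) : u • x = u.re • x + u.im • (Complex.I • x) := by
  conv_lhs => rw [← Complex.re_add_im u, add_smul, mul_smul]
  rfl

theorem riemannForm_smul_smul {E : A.V →ₗ[ℝ] A.V →ₗ[ℝ] ℝ}
    (h2 : ∀ u v, E (Complex.I • u) (Complex.I • v) = E u v) {u : ℂ} (hu : ‖u‖ = 1) (x y : A.V) :
    E (u • x) (u • y) = E x y := by
  have h3 : E (Complex.I • x) y = - E x (Complex.I • y) := by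
    have := h2 x (Complex.I • y)
    rw [smul_smul, Complex.I_mul_I, neg_one_smul, map_neg] at this
    rw [← this, neg_neg]
  have h4 : u.re * u.re + u.im * u.im = 1 := by
    have := Complex.normSq_apply u
    rw [Complex.normSq_eq_norm_sq, hu] at this
    linarith
  rw [complex_smul_eq u x, complex_smul_eq u y]
  simp only [map_add, map_smul, LinearMap.add_apply, LinearMap.smul_apply, smul_eq_mul, h2, h3]
  linear_combination (E x y) * h4

variable (A) in
/-- The automorphisms of `H¹(A, ℂ)` which preserve the bivector `∑ E(vᵢ, vⱼ) vᵢ* ⊗ vⱼ*`, that is,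
the class of `E`; here `v` is the lattice basis and `M E Mᵗ = E` expresses the invariance in terms
of the matrix `M` of `g`. -/
def formStabilizer (E : A.V →ₗ[ℝ] A.V →ₗ[ℝ] ℝ) : Subgroup (A.H1 ≃ₗ[ℂ] A.H1) where
  carrier := {g | LinearMap.toMatrix A.h1Basis A.h1Basis g.toLinearMap *
    Matrix.of (fun i j => (E (A.latticeBasis i) (A.latticeBasis j) : ℂ)) *
    (LinearMap.toMatrix A.h1Basis A.h1Basis g.toLinearMap).transpose =
    Matrix.of (fun i j => (E (A.latticeBasis i) (A.latticeBasis j) : ℂ))}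
  one_mem' := by
    have : (1 : A.H1 ≃ₗ[ℂ] A.H1).toLinearMap = LinearMap.id := rfl
    rw [Set.mem_ofPred_eq, this, LinearMap.toMatrix_id]
    simp
  mul_mem' {g h} hg hh := by
    have : (g * h).toLinearMap = g.toLinearMap ∘ₗ h.toLinearMap := rfl
    rw [Set.mem_ofPred_eq] at hg hh ⊢
    rw [this, LinearMap.toMatrix_comp A.h1Basis A.h1Basis A.h1Basis, Matrix.transpose_mul]
    conv_rhs => rw [← hg, ← hh]
    simp only [Matrix.mul_assoc]
  inv_mem' {g} hg := by
    have h1 : LinearMap.toMatrix A.h1Basis A.h1Basis g⁻¹.toLinearMap *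
        LinearMap.toMatrix A.h1Basis A.h1Basis g.toLinearMap = 1 := by
      rw [← LinearMap.toMatrix_comp A.h1Basis A.h1Basis A.h1Basis]
      have : g⁻¹.toLinearMap ∘ₗ g.toLinearMap = LinearMap.id := by
        ext1 φ
        exact g.symm_apply_apply φ
      rw [this, LinearMap.toMatrix_id]
    rw [Set.mem_ofPred_eq] at hg ⊢
    conv_lhs => rw [← hg]
    set M := LinearMap.toMatrix A.h1Basis A.h1Basis g.toLinearMap
    set M' := LinearMap.toMatrix A.h1Basis A.h1Basis g⁻¹.toLinearMap
    set F := Matrix.of (fun i j => (E (A.latticeBasis i) (A.latticeBasis j) : ℂ))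
    have h2 : M.transpose * M'.transpose = 1 := by
      rw [← Matrix.transpose_mul, h1, Matrix.transpose_one]
    calc M' * (M * F * M.transpose) * M'.transpose
        = (M' * M) * F * (M.transpose * M'.transpose) := by simp only [Matrix.mul_assoc]
      _ = F := by rw [h1, h2, Matrix.one_mul, Matrix.mul_one]

theorem mem_formStabilizer_iff {E : A.V →ₗ[ℝ] A.V →ₗ[ℝ] ℝ} {g : A.H1 ≃ₗ[ℂ] A.H1} :
    g ∈ A.formStabilizer E ↔ ∀ i j, ∑ q, ∑ p, entries g (i, p) *
      (E (A.latticeBasis p) (A.latticeBasis q) : ℂ) * entries g (j, q) =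
        (E (A.latticeBasis i) (A.latticeBasis j) : ℂ) := by
  change _ = _ ↔ _
  rw [← Matrix.ext_iff]
  simp only [Matrix.mul_apply, Matrix.transpose_apply, Matrix.of_apply, LinearMap.toMatrix_apply,
    LinearEquiv.coe_coe, Finset.sum_mul]
  rfl

theorem hodgeGroup_le_formStabilizer {E : A.V →ₗ[ℝ] A.V →ₗ[ℝ] ℝ}
    (h2 : ∀ u v, E (Complex.I • u) (Complex.I • v) = E u v)
    (h3 : ∀ u ∈ A.lattice, ∀ v ∈ A.lattice, ∃ m : ℤ, E u v = m) :
    A.hodgeGroup ≤ A.formStabilizer E := by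
  choose m hm using fun i j => h3 _ (A.latticeBasis_mem i) _ (A.latticeBasis_mem j)
  refine hodgeGroup_le ?_ fun u hu h1 => ?_
  · refine isRationalAlgebraic_of_entries {f | ∃ i j, f = ∑ q, ∑ p, MvPolynomial.X (i, p) *
      MvPolynomial.C (m p q : ℚ) * MvPolynomial.X (j, q) - MvPolynomial.C (m i j : ℚ)} fun g => ?_
    rw [mem_formStabilizer_iff]
    have key : ∀ i j, MvPolynomial.aeval (entries g) (∑ q, ∑ p, MvPolynomial.X (i, p) *
        MvPolynomial.C (m p q : ℚ) * MvPolynomial.X (j, q) - MvPolynomial.C (m i j : ℚ)) =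
        ∑ q, ∑ p, entries g (i, p) * (E (A.latticeBasis p) (A.latticeBasis q) : ℂ) *
          entries g (j, q) - (E (A.latticeBasis i) (A.latticeBasis j) : ℂ) := by
      intro i j
      simp [hm]
    constructor
    · rintro h f ⟨i, j, rfl⟩
      rw [key, h, sub_self]
    · intro h i j
      rw [← sub_eq_zero, ← key]
      exact h _ ⟨i, j, rfl⟩
  · rw [mem_formStabilizer_iff]
    intro i j
    have he : ∀ i p, entries (A.scalarAut u hu) (i, p) =
        (A.latticeBasis.repr (u • A.latticeBasis i) p : ℂ) := by
      intro i p
      rw [entries, h1Basis_repr, scalarAut_apply, h1Basis, complexDualBasis_apply]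
    have hE : E (A.latticeBasis i) (A.latticeBasis j) = ∑ q, ∑ p,
        A.latticeBasis.repr (u • A.latticeBasis i) p * E (A.latticeBasis p) (A.latticeBasis q) *
          A.latticeBasis.repr (u • A.latticeBasis j) q := by
      rw [← riemannForm_smul_smul h2 h1]
      conv_lhs => rw [← A.latticeBasis.sum_repr (u • A.latticeBasis i),
        ← A.latticeBasis.sum_repr (u • A.latticeBasis j)]
      simp only [map_sum, LinearMap.sum_apply, map_smul, LinearMap.smul_apply, smul_eq_mul]
      refine Finset.sum_congr rfl fun q _ => ?_
      rw [Finset.mul_sum]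
      exact Finset.sum_congr rfl fun p _ => by ring
    rw [hE]
    simp only [he]
    push_cast
    rfl

/-- The invariance of `E` expressed with an arbitrary `ℝ`-basis `w` of `V`. -/
theorem sum_mul_of_mem_formStabilizer {E : A.V →ₗ[ℝ] A.V →ₗ[ℝ] ℝ} {g : A.H1 ≃ₗ[ℂ] A.H1}
    (hg : g ∈ A.formStabilizer E) {n : ℕ} (w : Module.Basis (Fin n) ℝ A.V) (x y : A.V) :
    ∑ q, ∑ p, g (complexDualBasis w p) x * (E (w p) (w q) : ℂ) * g (complexDualBasis w q) y =
      (E x y : ℂ) := by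
  rw [mem_formStabilizer_iff] at hg
  set v := A.latticeBasis
  set b := A.h1Basis
  have h0 : ∀ i j, ∑ q, ∑ p, g (b p) (v i) * (E (v p) (v q) : ℂ) * g (b q) (v j) =
      (E (v i) (v j) : ℂ) := by
    intro i j
    rw [← hg i j]
    simp only [entries, h1Basis_repr]
    rfl
  have h1 : ∀ x j, ∑ q, ∑ p, g (b p) x * (E (v p) (v q) : ℂ) * g (b q) (v j) =
      (E x (v j) : ℂ) := by
    intro x j
    have : ∑ q, ∑ p, ((E (v p) (v q) : ℂ) * g (b q) (v j)) • g (b p) =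
        Complex.ofRealLI.toLinearMap ∘ₗ E.flip (v j) := by
      refine h1_ext fun i => ?_
      refine Eq.trans ?_ (h0 i j)
      simp only [LinearMap.sum_apply, LinearMap.smul_apply, smul_eq_mul]
      exact Finset.sum_congr rfl fun q _ => Finset.sum_congr rfl fun p _ => by ring
    refine Eq.trans ?_ (LinearMap.congr_fun this x)
    simp only [LinearMap.sum_apply, LinearMap.smul_apply, smul_eq_mul]
    exact Finset.sum_congr rfl fun q _ => Finset.sum_congr rfl fun p _ => by ring
  have h2 : ∀ x y, ∑ q, ∑ p, g (b p) x * (E (v p) (v q) : ℂ) * g (b q) y = (E x y : ℂ) := by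
    intro x y
    have : ∑ q, ∑ p, (g (b p) x * (E (v p) (v q) : ℂ)) • g (b q) =
        Complex.ofRealLI.toLinearMap ∘ₗ E x := by
      refine h1_ext fun j => ?_
      refine Eq.trans ?_ (h1 x j)
      simp only [LinearMap.sum_apply, LinearMap.smul_apply, smul_eq_mul]
      rfl
    refine Eq.trans ?_ (LinearMap.congr_fun this y)
    simp only [LinearMap.sum_apply, LinearMap.smul_apply, smul_eq_mul]
  have h3 : ∀ p x, g (complexDualBasis w p) x = ∑ k, (w.repr (v k) p : ℂ) * g (b k) x := by
    intro p x
    have : complexDualBasis w p = ∑ k, (w.repr (v k) p : ℂ) • b k := by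
      conv_lhs => rw [← b.sum_repr (complexDualBasis w p)]
      refine Finset.sum_congr rfl fun k _ => ?_
      rw [h1Basis_repr, complexDualBasis_apply]
    rw [this]
    simp only [map_sum, map_smul, LinearMap.sum_apply, LinearMap.smul_apply, smul_eq_mul]
  have h4 : ∀ k l, (E (v k) (v l) : ℂ) =
      ∑ q, ∑ p, (w.repr (v k) p : ℂ) * (E (w p) (w q) : ℂ) * (w.repr (v l) q : ℂ) := by
    intro k l
    conv_lhs => rw [← w.sum_repr (v k), ← w.sum_repr (v l)]
    simp only [map_sum, LinearMap.sum_apply, map_smul, LinearMap.smul_apply, smul_eq_mul]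
    push_cast
    refine Finset.sum_congr rfl fun q _ => ?_
    rw [Finset.mul_sum]
    exact Finset.sum_congr rfl fun p _ => by ring
  rw [← h2 x y]
  simp only [h3, h4, Finset.mul_sum, Finset.sum_mul]
  have e1 : ∀ f : Fin n → Fin n → Fin A.latticeRank → Fin A.latticeRank → ℂ,
      ∑ q, ∑ p, ∑ k, ∑ l, f q p k l = ∑ k, ∑ l, ∑ q, ∑ p, f q p k l := by
    intro f
    calc ∑ q, ∑ p, ∑ k, ∑ l, f q p k l = ∑ q, ∑ k, ∑ p, ∑ l, f q p k l :=
          Finset.sum_congr rfl fun q _ => Finset.sum_comm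
      _ = ∑ k, ∑ q, ∑ p, ∑ l, f q p k l := Finset.sum_comm
      _ = ∑ k, ∑ q, ∑ l, ∑ p, f q p k l := Finset.sum_congr rfl fun k _ =>
          Finset.sum_congr rfl fun q _ => Finset.sum_comm
      _ = _ := Finset.sum_congr rfl fun k _ => Finset.sum_comm
  rw [e1]
  refine Finset.sum_congr rfl fun k _ => Finset.sum_congr rfl fun l _ =>
    Finset.sum_congr rfl fun q _ => Finset.sum_congr rfl fun p _ => ?_
  ring

variable (A) in
/-- The Hodge group is stable under the adjoint with respect to a Hermitian inner product on
`H¹(A, ℂ)`. With `C` the action of `i`, the adjoint of `g` is `C⁻¹ ḡ⁻¹ C`. -/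
theorem exists_basis_adjoint_mem_hodgeGroup :
    ∃ (d : ℕ) (o : Module.Basis (Fin d) ℂ A.H1), ∀ g ∈ A.hodgeGroup, ∃ g' ∈ A.hodgeGroup,
      ∀ i j, o.repr (g' (o j)) i = starRingEnd ℂ (o.repr (g (o i)) j) := by
  obtain ⟨E, h1, h2, h3, h4⟩ := A.exists_riemannForm
  have hfin : FiniteDimensional ℝ A.V := Module.Finite.of_basis A.latticeBasis
  have halt : ∀ x y, E x y = - E y x := by
    intro x y
    have := h1 (x + y)
    simp only [map_add, LinearMap.add_apply, h1] at this
    linarith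
  have hI : ∀ x y, E (Complex.I • x) y = - E x (Complex.I • y) := by
    intro x y
    have := h2 x (Complex.I • y)
    rw [smul_smul, Complex.I_mul_I, neg_one_smul, map_neg] at this
    rw [← this, neg_neg]
  let J : A.V →ₗ[ℝ] A.V := (Complex.I • LinearMap.id : A.V →ₗ[ℂ] A.V).restrictScalars ℝ
  obtain ⟨n, w, hw⟩ := exists_basis_orthonormal_of_posDef (E.compl₂ J)
    (fun x y => by
      change E x (Complex.I • y) = E y (Complex.I • x)
      rw [halt, hI, neg_neg]) (fun x hx => h4 x hx)
  have hw' : ∀ i j, E (w i) (Complex.I • w j) = if i = j then 1 else 0 := hw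
  -- In the orthonormal basis `w` the matrix of `C` is that of `E`.
  have hJ : ∀ i j, w.repr (Complex.I • w j) i = E (w j) (w i) := by
    intro i j
    have h5 : E (w i) (Complex.I • (Complex.I • w j)) = w.repr (Complex.I • w j) i := by
      conv_lhs => rw [← w.sum_repr (Complex.I • w j)]
      simp only [Finset.smul_sum, smul_comm Complex.I, map_sum, map_smul, hw', smul_eq_mul]
      simp
    rw [← h5, smul_smul, Complex.I_mul_I, neg_one_smul, map_neg, halt, neg_neg]
  let o := complexDualBasis w
  have ho : ∀ j x, o j x = (w.repr x j : ℂ) := complexDualBasis_apply w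
  refine ⟨n, o, fun g hg => ?_⟩
  let c : ℂ ≃+* ℂ := starRingAut
  let C := A.scalarAut Complex.I Complex.I_ne_zero
  have hC : C ∈ A.hodgeGroup := A.scalarAut_mem_hodgeGroup _ _ Complex.norm_I
  have hgc := galoisConj_mem_hodgeGroup c hg
  refine ⟨C⁻¹ * (A.galoisConj c g)⁻¹ * C, mul_mem (mul_mem (inv_mem hC) (inv_mem hgc)) hC, ?_⟩
  have hgo : ∀ p x, A.galoisConj c g (o p) x = starRingEnd ℂ (g (o p) x) := by
    intro p x
    have : (A.galois c).symm (o p) = o p := by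
      rw [AddEquiv.symm_apply_eq]
      ext x
      rw [galois_conj, ho, Complex.conj_ofReal]
    rw [galoisConj_apply, this, galois_conj]
  have hCo : ∀ q, C (o q) = ∑ p, (E (w p) (w q) : ℂ) • o p := by
    intro q
    conv_lhs => rw [← o.sum_repr (C (o q))]
    refine Finset.sum_congr rfl fun p _ => ?_
    rw [complexDualBasis_repr, scalarAut_apply, ho, hJ]
  have key : ∀ j, A.galoisConj c g (C (∑ q, starRingEnd ℂ (g (o q) (w j)) • o q)) = C (o j) := by
    intro j
    refine w.ext fun i => ?_
    have h6 := sum_mul_of_mem_formStabilizer (hodgeGroup_le_formStabilizer h2 h3 hg) w (w i) (w j)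
    have h7 : C (o j) (w i) = (E (w i) (w j) : ℂ) := by
      rw [scalarAut_apply, ho, hJ]
    rw [h7, ← Complex.conj_ofReal, ← h6]
    simp only [map_sum, map_smul, hCo, LinearMap.sum_apply, LinearMap.smul_apply, hgo, smul_eq_mul,
      Finset.mul_sum, map_mul]
    refine Finset.sum_congr rfl fun q _ => Finset.sum_congr rfl fun p _ => ?_
    rw [Complex.conj_ofReal]
    change _ = starRingEnd ℂ (g (o p) (w i)) * _ * starRingEnd ℂ (g (o q) (w j))
    ring
  intro i j
  have h8 : (C⁻¹ * (A.galoisConj c g)⁻¹ * C) (o j) = ∑ q, starRingEnd ℂ (g (o q) (w j)) • o q := by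
    rw [LinearEquiv.mul_apply, ← key j]
    change C.symm ((A.galoisConj c g).symm _) = _
    rw [LinearEquiv.symm_apply_apply, LinearEquiv.symm_apply_apply]
  rw [h8, o.repr_sum_self, complexDualBasis_repr]

end ComplexAbelianVariety

namespace ComplexAbelianVariety

variable {A B : ComplexAbelianVariety}

/-! ### Descent of equivariant maps to the rational numbers -/

theorem galois_sum {ι : Type*} [Fintype ι] (σ : ℂ ≃+* ℂ) (a : ι → ℂ) {x : ι → A.H1}
    (hx : ∀ i, x i ∈ A.H1Over ℚ) :
    A.galois σ (∑ i, a i • x i) = ∑ i, σ (a i) • x i := by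
  rw [map_sum]
  exact Finset.sum_congr rfl fun i _ => by rw [galois_smul, galois_of_mem _ _ (hx i)]

theorem galois_h1ProdEquiv (σ : ℂ ≃+* ℂ) (φ : A.H1 × B.H1) :
    (A.prod B).galois σ (h1ProdEquiv A B φ) =
      h1ProdEquiv A B (A.galois σ φ.1, B.galois σ φ.2) := by
  let b := h1ProdBasis A.h1Basis B.h1Basis
  have hb := h1ProdBasis_mem A.h1Basis B.h1Basis (A.h1Basis_mem ℚ) (B.h1Basis_mem ℚ)
  have h1 : (A.prod B).galois σ (h1ProdEquiv A B φ) =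
      ∑ i, σ (b.repr (h1ProdEquiv A B φ) i) • b i := by
    conv_lhs => rw [← b.sum_repr (h1ProdEquiv A B φ)]
    exact galois_sum σ _ hb
  rw [h1]
  refine b.ext_elem fun i => ?_
  rw [b.repr_sum_self]
  obtain ⟨i | i, rfl⟩ := finSumFinEquiv.surjective i
  · rw [h1ProdBasis_repr_inl, h1ProdBasis_repr_inl, h1Basis_repr, h1Basis_repr,
      galois_apply_latticeBasis]
  · rw [h1ProdBasis_repr_inr, h1ProdBasis_repr_inr, h1Basis_repr, h1Basis_repr,
      galois_apply_latticeBasis]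

theorem galoisConj_blockSum (σ : ℂ ≃+* ℂ) (g : A.H1 ≃ₗ[ℂ] A.H1) (h : B.H1 ≃ₗ[ℂ] B.H1) :
    (A.prod B).galoisConj σ (blockSum g h) =
      blockSum (A.galoisConj σ g) (B.galoisConj σ h) := by
  refine (eq_blockSum_iff _ _ _).2 fun φ => ?_
  have h1 : ((A.prod B).galois σ).symm (h1ProdEquiv A B φ) =
      h1ProdEquiv A B ((A.galois σ).symm φ.1, (B.galois σ).symm φ.2) := by
    rw [AddEquiv.symm_apply_eq, galois_h1ProdEquiv]
    simp
  rw [galoisConj_apply, h1, blockSum_h1ProdEquiv, galois_h1ProdEquiv]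
  rfl

theorem entries_galoisConj (σ : ℂ ≃+* ℂ) (g : A.H1 ≃ₗ[ℂ] A.H1) :
    entries (A.galoisConj σ g) = fun ij => σ (entries g ij) :=
  funext fun ij => repr_galoisConj σ g A.h1Basis (A.h1Basis_mem ℚ) ij.1 ij.2

theorem cohBasis_mem_totalCohOver (k : Type*) [Field k] [Algebra k ℂ] (s) :
    A.cohBasis s ∈ A.totalCohOver k := by
  rw [totalCohOver_eq_span]
  exact Submodule.subset_span ⟨s, rfl⟩

/-- A `ℂ`-linear map which commutes with `G(A × B)` is a combination of rational maps with the same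
property. The point is that `G(A × B)` is stable under `Aut ℂ`: if `∑ cᵢ Φᵢ` is equivariant,
with `Φᵢ` rational, then so are its conjugates `∑ σ(cᵢ) Φᵢ`, and the vectors of conjugates of
numbers `cᵢ` that are linearly independent over `ℚ` are linearly independent. -/
theorem exists_rational_equivariant_components {Ψ : A.Coh →ₗ[ℂ] B.Coh}
    (hΨ : ∀ (g : A.H1 ≃ₗ[ℂ] A.H1) (h : B.H1 ≃ₗ[ℂ] B.H1), blockSum g h ∈ (A.prod B).hodgeGroup →
      ∀ x, Ψ (act g x) = act h (Ψ x))
    {n : ℕ} (hn : ∀ x, Ψ x ∈ B.cohDegree n) :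
    ∃ (m : ℕ) (c : Fin m → ℂ) (Φ : Fin m → A.Coh →ₗ[ℂ] B.Coh),
      (∀ x, Ψ x = ∑ i, c i • Φ i x) ∧
      (∀ i, ∀ x ∈ A.totalCohOver ℚ, Φ i x ∈ B.cohOver ℚ n) ∧
      ∀ i (g : A.H1 ≃ₗ[ℂ] A.H1) (h : B.H1 ≃ₗ[ℂ] B.H1), blockSum g h ∈ (A.prod B).hodgeGroup →
        ∀ x, Φ i (act g x) = act h (Φ i x) := by
  let ψ := fun (s : Finset (Fin B.latticeRank)) (t : Finset (Fin A.latticeRank)) =>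
    B.cohBasis.coord s (Ψ (A.cohBasis t))
  let L := Submodule.span ℚ (Set.range fun st :
    Finset (Fin B.latticeRank) × Finset (Fin A.latticeRank) => ψ st.1 st.2)
  have hL : FiniteDimensional ℚ L := FiniteDimensional.span_of_finite ℚ (Set.finite_range _)
  have hψ : ∀ s t, ψ s t ∈ L := fun s t => Submodule.subset_span ⟨(s, t), rfl⟩
  let bL := Module.finBasis ℚ L
  let c := fun i => (bL i : ℂ)
  have hc : LinearIndependent ℚ c :=
    bL.linearIndependent.map' L.subtype (LinearMap.ker_eq_bot.2 L.subtype_injective)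
  let q := fun i s t => bL.repr ⟨ψ s t, hψ s t⟩ i
  have hq : ∀ s t, ψ s t = ∑ i, c i * (q i s t : ℂ) := by
    intro s t
    have := congrArg Subtype.val (bL.sum_repr ⟨ψ s t, hψ s t⟩)
    rw [AddSubmonoidClass.coe_finsetSum] at this
    refine this.symm.trans (Finset.sum_congr rfl fun i _ => ?_)
    rw [SetLike.val_smul, Rat.smul_def, mul_comm]
  let Φ := fun i => A.cohBasis.constr ℂ fun t => ∑ s, (q i s t : ℂ) • B.cohBasis s
  have hΦ : ∀ i t, Φ i (A.cohBasis t) = ∑ s, (q i s t : ℂ) • B.cohBasis s := fun i t =>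
    Module.Basis.constr_basis _ _ _ _
  have hΨΦ : ∀ x, Ψ x = ∑ i, c i • Φ i x := by
    intro x
    have : Ψ = ∑ i, c i • Φ i := by
      refine A.cohBasis.ext fun t => ?_
      rw [LinearMap.sum_apply]
      simp only [LinearMap.smul_apply, hΦ, Finset.smul_sum, smul_smul]
      rw [Finset.sum_comm]
      conv_lhs => rw [← B.cohBasis.sum_repr (Ψ (A.cohBasis t))]
      refine Finset.sum_congr rfl fun s _ => ?_
      rw [← Finset.sum_smul, ← hq]
      rfl
    rw [this, LinearMap.sum_apply]
    rfl
  have hΦn : ∀ i, ∀ x ∈ A.totalCohOver ℚ, Φ i x ∈ B.cohOver ℚ n := by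
    intro i x hx
    rw [totalCohOver_eq_span] at hx
    induction hx using Submodule.span_induction with
    | mem x hx =>
      obtain ⟨t, rfl⟩ := hx
      rw [hΦ, cohOver_eq_span]
      refine sum_mem fun s _ => ?_
      by_cases hs : s.card = n
      · rw [Rat.cast_smul_eq_qsmul]
        exact Submodule.smul_mem _ _ (Submodule.subset_span (Set.mem_image_of_mem _ hs))
      · have h0 : ψ s t = 0 := (B.mem_cohDegree_iff n _).1 (hn _) s hs
        have h1 : (⟨ψ s t, hψ s t⟩ : L) = 0 := Subtype.ext h0
        have : q i s t = 0 := by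
          change bL.repr ⟨ψ s t, hψ s t⟩ i = 0
          rw [h1, map_zero, Finsupp.zero_apply]
        rw [this, Rat.cast_zero, zero_smul]
        exact zero_mem _
    | zero => rw [map_zero]; exact zero_mem _
    | add x y _ _ hx hy => rw [map_add]; exact add_mem hx hy
    | smul a x _ hx =>
      rw [← Rat.cast_smul_eq_qsmul ℂ, map_smul, Rat.cast_smul_eq_qsmul]
      exact Submodule.smul_mem _ _ hx
  refine ⟨_, c, Φ, hΨΦ, hΦn, fun i g h hgh x => ?_⟩
  have key : ∀ t s, B.cohBasis.coord s (Φ i (act g (A.cohBasis t))) =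
      B.cohBasis.coord s (act h (Φ i (A.cohBasis t))) := by
    intro t s
    choose F hF using fun i => exists_mvPolynomial_act (B.cohBasis.coord s ∘ₗ Φ i)
      (fun t => by
        refine ⟨q i s t, ?_⟩
        rw [LinearMap.comp_apply, hΦ, Module.Basis.coord_apply, B.cohBasis.repr_sum_self])
      (cohBasis_mem_totalCohOver ℚ t)
    choose G hG using fun i => exists_mvPolynomial_act (B.cohBasis.coord s)
      (fun r => by
        obtain ⟨a, ha⟩ := coord_cohBasis_mem (cohBasis_mem_totalCohOver (A := B) ℚ r) s
        exact ⟨a, ha.symm⟩)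
      (B.cohOver_le_totalCohOver ℚ n (hΦn i _ (cohBasis_mem_totalCohOver ℚ t)))
    have hsum : ∀ (g : A.H1 ≃ₗ[ℂ] A.H1) (h : B.H1 ≃ₗ[ℂ] B.H1),
        blockSum g h ∈ (A.prod B).hodgeGroup →
        ∑ i, c i * (MvPolynomial.aeval (entries g) (F i) -
          MvPolynomial.aeval (entries h) (G i)) = 0 := by
      intro g h hgh
      have h1 := congrArg (B.cohBasis.coord s) (hΨ g h hgh (A.cohBasis t))
      rw [hΨΦ, hΨΦ] at h1
      simp only [map_sum, map_smul, smul_eq_mul] at h1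
      simp only [mul_sub, Finset.sum_sub_distrib, ← hF, ← hG, sub_eq_zero]
      exact h1
    have hzero := Complex.eq_zero_of_forall_sum_ringEquiv hc
      (y := fun i => MvPolynomial.aeval (entries g) (F i) - MvPolynomial.aeval (entries h) (G i))
      (fun σ => by
        have h1 := hsum (A.galoisConj σ.symm g) (B.galoisConj σ.symm h)
          (galoisConj_blockSum σ.symm g h ▸ galoisConj_mem_hodgeGroup σ.symm hgh)
        simp only [entries_galoisConj, MvPolynomial.aeval_ringEquiv] at h1
        have h2 := congrArg σ h1
        simpa only [map_sum, map_mul, map_sub, RingEquiv.apply_symm_apply, map_zero] using h2)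
    have := congrFun hzero i
    simp only [Pi.zero_apply, sub_eq_zero, ← hF, ← hG] at this
    exact this
  have : Φ i ∘ₗ act g = act h ∘ₗ Φ i :=
    A.cohBasis.ext fun t => B.cohBasis.ext_elem fun s => key t s
  exact LinearMap.congr_fun this x

end ComplexAbelianVariety

/-! ### Morphisms of Hodge structures -/

namespace HodgeStructure

variable {W : Type*} [AddCommGroup W] [Module ℚ W] {N : Type*} [AddCommGroup N] [Module ℚ N]

theorem iSup_piece (S : HodgeStructure W) : ⨆ pq : ℤ × ℤ, S.piece pq.1 pq.2 = ⊤ :=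
  S.isInternal.submodule_iSup_eq_top

theorem conjC_baseChange (f : W →ₗ[ℚ] N) (x : ℂ ⊗[ℚ] W) :
    conjC N (f.baseChange ℂ x) = f.baseChange ℂ (conjC W x) := by
  induction x with
  | zero => simp
  | tmul z w => simp [conjC]
  | add x y hx hy => simp only [map_add, hx, hy]

/-- The Hodge structure transported along an isomorphism of rational vector spaces. -/
def transport (S : HodgeStructure W) (e : W ≃ₗ[ℚ] N) : HodgeStructure N where
  weight := S.weight
  piece p q := (S.piece p q).map (e.toLinearMap.baseChange ℂ)
  finite := by
    have := S.finite
    exact Module.Finite.equiv e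
  piece_eq_bot p q h := by rw [S.piece_eq_bot p q h, Submodule.map_bot]
  isInternal := by
    have h := S.isInternal
    rw [DirectSum.isInternal_submodule_iff_iSupIndep_and_iSup_eq_top] at h ⊢
    let E : (ℂ ⊗[ℚ] W) ≃ₗ[ℂ] (ℂ ⊗[ℚ] N) := e.baseChange ℚ ℂ W N
    refine ⟨h.1.map_orderIso (Submodule.orderIsoMapComap E), ?_⟩
    rw [← Submodule.map_iSup, h.2, Submodule.map_top, LinearMap.range_eq_top]
    exact E.surjective
  conj_mem p q x hx := by
    obtain ⟨z, hz, rfl⟩ := hx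
    exact ⟨conjC W z, S.conj_mem p q z hz, (conjC_baseChange _ _).symm⟩

theorem transport_isomorphic (S : HodgeStructure W) (e : W ≃ₗ[ℚ] N) :
    (S.transport e).Isomorphic S := by
  refine ⟨rfl, e.symm, fun p q => ?_⟩
  change ((S.piece p q).map (e.toLinearMap.baseChange ℂ)).map (e.symm.toLinearMap.baseChange ℂ) = _
  rw [← Submodule.map_comp, ← LinearMap.baseChange_comp, LinearEquiv.comp_coe,
    LinearEquiv.self_trans_symm, LinearEquiv.refl_toLinearMap, LinearMap.baseChange_id,
    Submodule.map_id]

theorem baseChange_subtype_injective (U : Submodule ℚ W) :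
    Function.Injective (U.subtype.baseChange ℂ) :=
  Module.Flat.lTensor_preserves_injective_linearMap _ U.subtype_injective

/-- The subspace `U` with the induced pieces, when these span `U_ℂ`. -/
def restrict (S : HodgeStructure W) (U : Submodule ℚ W)
    (hU : ⨆ pq : ℤ × ℤ, (S.piece pq.1 pq.2).comap (U.subtype.baseChange ℂ) = ⊤) :
    HodgeStructure U where
  weight := S.weight
  piece p q := (S.piece p q).comap (U.subtype.baseChange ℂ)
  finite := by
    have := S.finite
    infer_instance
  piece_eq_bot p q h := by
    rw [S.piece_eq_bot p q h, Submodule.comap_bot, LinearMap.ker_eq_bot]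
    exact baseChange_subtype_injective U
  isInternal := by
    have h := S.isInternal
    rw [DirectSum.isInternal_submodule_iff_iSupIndep_and_iSup_eq_top] at h ⊢
    refine ⟨fun i => ?_, hU⟩
    have h1 := h.1 i
    rw [Submodule.disjoint_def] at h1 ⊢
    intro x hx hx'
    apply baseChange_subtype_injective U
    rw [map_zero]
    refine h1 _ hx ?_
    have h2 : (⨆ j, ⨆ (_ : j ≠ i), (S.piece j.1 j.2).comap (U.subtype.baseChange ℂ)) ≤
        (⨆ j, ⨆ (_ : j ≠ i), S.piece j.1 j.2).comap (U.subtype.baseChange ℂ) :=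
      iSup₂_le fun j hj => Submodule.comap_mono (le_iSup₂_of_le j hj le_rfl)
    exact h2 hx'
  conj_mem p q x hx := by
    change U.subtype.baseChange ℂ _ ∈ S.piece q p
    rw [← conjC_baseChange]
    exact S.conj_mem p q _ hx

/-- A rational linear map on an irreducible Hodge structure whose complexification respects
some independent families of subspaces is zero or injective. -/
theorem IsIrreducible.eq_zero_or_injective {S : HodgeStructure W} (hS : S.IsIrreducible)
    (f : W →ₗ[ℚ] N) (Q : ℤ × ℤ → Submodule ℂ (ℂ ⊗[ℚ] N)) (hQ : iSupIndep Q)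
    (hf : ∀ p q, ∀ z ∈ S.piece p q, f.baseChange ℂ z ∈ Q (p, q)) :
    f = 0 ∨ Function.Injective f := by
  classical
  let U := LinearMap.ker f
  have hU : ⨆ pq : ℤ × ℤ, (S.piece pq.1 pq.2).comap (U.subtype.baseChange ℂ) = ⊤ := by
    rw [eq_top_iff]
    rintro x -
    have hker : LinearMap.ker (f.baseChange ℂ) = LinearMap.range (U.subtype.baseChange ℂ) :=
      Module.Flat.ker_lTensor_eq (S := ℂ) (M := ℂ) f
    let _ := S.isInternal.chooseDecomposition
    let P : ℤ × ℤ → Submodule ℂ (ℂ ⊗[ℚ] W) := fun pq => S.piece pq.1 pq.2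
    let z := U.subtype.baseChange ℂ x
    let s := (DirectSum.decompose P z).support
    have hz : ∑ i ∈ s, (DirectSum.decompose P z i : ℂ ⊗[ℚ] W) = z :=
      DirectSum.sum_support_decompose P z
    have hz0 : f.baseChange ℂ z = 0 := by
      have : z ∈ LinearMap.ker (f.baseChange ℂ) := by
        rw [hker]; exact ⟨x, rfl⟩
      exact this
    have h1 : ∀ i ∈ s, f.baseChange ℂ (DirectSum.decompose P z i) = 0 := by
      refine (iSupIndep_iff_finsetSum_eq_zero_imp_eq_zero Q).1 hQ s _ (fun i _ => ?_) ?_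
      · exact hf i.1 i.2 _ (DirectSum.decompose P z i).2
      · rw [← map_sum, hz, hz0]
    have h2 : ∀ i ∈ s, ∃ y, U.subtype.baseChange ℂ y = DirectSum.decompose P z i := by
      intro i hi
      have : (DirectSum.decompose P z i : ℂ ⊗[ℚ] W) ∈ LinearMap.ker (f.baseChange ℂ) := h1 i hi
      rwa [hker] at this
    choose! y hy using h2
    have hx : x = ∑ i ∈ s, y i := by
      apply baseChange_subtype_injective U
      rw [map_sum, Finset.sum_congr rfl hy, hz]
    rw [hx]
    refine sum_mem fun i hi => Submodule.mem_iSup_of_mem i ?_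
    rw [Submodule.mem_comap, hy i hi]
    exact (DirectSum.decompose P z i).2
  rcases hS.2 U (S.restrict U hU) ⟨rfl, fun p q => Submodule.map_comap_le _ _⟩ with h | h
  · exact Or.inr (LinearMap.ker_eq_bot.1 h)
  · exact Or.inl (LinearMap.ker_eq_top.1 h)

end HodgeStructure

namespace ComplexAbelianVariety

variable {A B : ComplexAbelianVariety}

/-! ### The Hodge decomposition and the circle -/

theorem exp_I_zpow_injective : Function.Injective fun k : ℤ => Complex.exp Complex.I ^ k := by
  intro k l h
  simp only [← Complex.exp_int_mul] at h
  obtain ⟨n, hn⟩ := Complex.exp_eq_exp_iff_exists_int.1 h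
  have h1 : ((k : ℝ) : ℂ) = ((l + n * (2 * Real.pi) : ℝ) : ℂ) := by
    apply mul_right_cancel₀ Complex.I_ne_zero
    push_cast
    rw [hn]
    ring
  have h2 : (k : ℝ) = l + n * (2 * Real.pi) := Complex.ofReal_injective h1
  by_cases h0 : n = 0
  · subst h0
    simp only [Int.cast_zero, zero_mul, add_zero] at h2
    exact_mod_cast h2
  · exfalso
    have h3 : (n : ℝ) ≠ 0 := by exact_mod_cast h0
    refine irrational_pi ⟨(k - l) / (2 * n), ?_⟩
    push_cast
    field_simp
    linarith

variable (A) in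
/-- The element of the Hodge group of `A` induced by a fixed element `exp(i)` of infinite order of
the circle. -/
def circleGen : A.H1 ≃ₗ[ℂ] A.H1 := A.scalarAut (Complex.exp Complex.I) (Complex.exp_ne_zero _)

theorem norm_exp_I : ‖Complex.exp Complex.I‖ = 1 := by
  simpa using Complex.norm_exp_ofReal_mul_I 1

variable (A) in
/-- The eigenspace of the circle on `H^⋆(A, ℂ)` for the character `u ↦ uʲ`. -/
def circleEigenspace (j : ℤ) : Submodule ℂ A.Coh :=
  Module.End.eigenspace (act A.circleGen) (Complex.exp Complex.I ^ j)

theorem mem_circleEigenspace {j : ℤ} {x : A.Coh} :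
    x ∈ A.circleEigenspace j ↔ act A.circleGen x = Complex.exp Complex.I ^ j • x :=
  Module.End.mem_eigenspace_iff

theorem iSupIndep_circleEigenspace : iSupIndep A.circleEigenspace :=
  (Module.End.eigenspaces_iSupIndep (act A.circleGen)).comp exp_I_zpow_injective

theorem act_scalarAut_of_mem_hodgeNat {u : ℂ} (hu : u ≠ 0) {p q : ℕ} {x : A.Coh}
    (hx : x ∈ A.hodgeNat p q) :
    act (A.scalarAut u hu) x = (u ^ p * starRingEnd ℂ u ^ q) • x := by
  have hmap : ∀ (g : A.H1 →ₗ[ℂ] A.H1) (M : Submodule ℂ A.H1) (c : ℂ), (∀ φ ∈ M, g φ = c • φ) →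
      ∀ (n : ℕ), ∀ x ∈ (M.map (ExteriorAlgebra.ι ℂ)) ^ n,
        ExteriorAlgebra.map g x = c ^ n • x := by
    intro g M c hM n x hx
    induction hx using Submodule.pow_induction_on_left' with
    | algebraMap r => simp
    | add x y i hx hy hx' hy' => rw [map_add, hx', hy', smul_add]
    | mem_mul m hm i x hx hx' =>
      obtain ⟨φ, hφ, rfl⟩ := hm
      rw [map_mul, hx', ExteriorAlgebra.map_apply_ι, hM φ hφ, map_smul, smul_mul_smul_comm,
        pow_succ']
  induction hx using Submodule.mul_induction_on' with
  | mem_mul_mem a ha b hb =>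
    have h1 : act (A.scalarAut u hu) a = u ^ p • a :=
      hmap _ A.H10 u (fun φ hφ => LinearMap.ext fun v => hφ u v) p a ha
    have h2 : act (A.scalarAut u hu) b = starRingEnd ℂ u ^ q • b :=
      hmap _ A.H01 (starRingEnd ℂ u) (fun φ hφ => LinearMap.ext fun v => hφ u v) q b hb
    have h3 : act (A.scalarAut u hu) (a * b) =
        act (A.scalarAut u hu) a * act (A.scalarAut u hu) b :=
      map_mul (ExteriorAlgebra.map (A.scalarAut u hu).toLinearMap) a b
    rw [h3, h1, h2, smul_mul_smul_comm]
  | add x _ y _ hx hy => rw [map_add, hx, hy, smul_add]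

theorem act_scalarAut_of_mem_hodge {u : ℂ} (hu : u ≠ 0) (h1 : ‖u‖ = 1) {p q : ℤ} {x : A.Coh}
    (hx : x ∈ A.hodge p q) : act (A.scalarAut u hu) x = u ^ (p - q) • x := by
  rw [hodge] at hx
  split_ifs at hx with h
  · rw [act_scalarAut_of_mem_hodgeNat hu hx]
    have h2 : starRingEnd ℂ u = u⁻¹ := by
      rw [Complex.inv_def, Complex.normSq_eq_norm_sq, h1]
      simp
    obtain ⟨p, rfl⟩ := Int.eq_ofNat_of_zero_le h.1
    obtain ⟨q, rfl⟩ := Int.eq_ofNat_of_zero_le h.2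
    rw [h2, zpow_sub₀ hu, Int.toNat_natCast, Int.toNat_natCast, zpow_natCast, zpow_natCast,
      inv_pow, div_eq_mul_inv]
  · rw [Submodule.mem_bot] at hx
    rw [hx, map_zero, smul_zero]

theorem hodge_le_circleEigenspace (p q : ℤ) : A.hodge p q ≤ A.circleEigenspace (p - q) :=
  fun _ hx => mem_circleEigenspace.2 (act_scalarAut_of_mem_hodge _ norm_exp_I hx)

variable (A) in
theorem H10_sup_H01 : A.H10 ⊔ A.H01 = ⊤ := by
  rw [eq_top_iff]
  rintro φ -
  let ψ : A.H1 := A.scalarAut Complex.I Complex.I_ne_zero φ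
  have hψ : ∀ v, ψ v = φ (Complex.I • v) := fun _ => rfl
  have hI : ∀ v, φ (Complex.I • Complex.I • v) = - φ v := fun v => by
    rw [smul_smul, Complex.I_mul_I, neg_one_smul, map_neg]
  have hc : ∀ (c : ℂ) v, φ (c • v) = c.re * φ v + c.im * φ (Complex.I • v) := fun c v => by
    rw [complex_smul_eq, map_add, map_smul, map_smul, Complex.real_smul, Complex.real_smul]
  have hc' : ∀ (c : ℂ) v, φ (Complex.I • c • v) = c.re * φ (Complex.I • v) - c.im * φ v :=
    fun c v => by
      rw [smul_comm, hc, hI]; ring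
  have e1 : (1 / 2 : ℂ) • (φ - Complex.I • ψ) ∈ A.H10 := by
    intro c v
    simp only [LinearMap.smul_apply, LinearMap.sub_apply, hψ, smul_eq_mul, hc', hc c v]
    conv_rhs => rw [← Complex.re_add_im c]
    linear_combination ((1 / 2) * c.im * φ (Complex.I • v)) * Complex.I_mul_I
  have e2 : (1 / 2 : ℂ) • (φ + Complex.I • ψ) ∈ A.H01 := by
    intro c v
    have hcc : starRingEnd ℂ c = c.re - c.im * Complex.I := by
      apply Complex.ext <;> simp
    simp only [LinearMap.smul_apply, LinearMap.add_apply, hψ, smul_eq_mul, hc', hc c v, hcc]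
    linear_combination ((1 / 2) * c.im * φ (Complex.I • v)) * Complex.I_mul_I
  have : φ = (1 / 2 : ℂ) • (φ - Complex.I • ψ) + (1 / 2 : ℂ) • (φ + Complex.I • ψ) := by
    module
  rw [this]
  exact Submodule.add_mem_sup e1 e2

theorem cohDegree_le_iSup_hodgeNat (n : ℕ) :
    A.cohDegree n ≤ ⨆ (p : ℕ) (q : ℕ) (_ : p + q = n), A.hodgeNat p q := by
  have hR : LinearMap.range (ExteriorAlgebra.ι ℂ (M := A.H1)) =
      A.H10.map (ExteriorAlgebra.ι ℂ) ⊔ A.H01.map (ExteriorAlgebra.ι ℂ) := by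
    rw [← Submodule.map_sup, H10_sup_H01, Submodule.map_top]
  have hanti : ∀ a ∈ A.H10.map (ExteriorAlgebra.ι ℂ), ∀ b ∈ A.H01.map (ExteriorAlgebra.ι ℂ),
      a * b = - (b * a) := by
    rintro _ ⟨φ, -, rfl⟩ _ ⟨ψ, -, rfl⟩
    exact eq_neg_of_add_eq_zero_left (ExteriorAlgebra.ι_add_mul_swap φ ψ)
  have hcomm : Commute (A.H01.map (ExteriorAlgebra.ι ℂ)) (A.H10.map (ExteriorAlgebra.ι ℂ)) := by
    apply le_antisymm
    · refine Submodule.mul_le.2 fun b hb a ha => ?_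
      rw [← neg_neg (b * a), ← hanti a ha b hb]
      exact neg_mem (Submodule.mul_mem_mul ha hb)
    · refine Submodule.mul_le.2 fun a ha b hb => ?_
      rw [hanti a ha b hb]
      exact neg_mem (Submodule.mul_mem_mul hb ha)
  induction n with
  | zero =>
    refine le_iSup_of_le 0 (le_iSup_of_le 0 (le_iSup_of_le rfl ?_))
    simp [cohDegree, hodgeNat]
  | succ n ih =>
    have h1 : A.cohDegree (n + 1) =
        LinearMap.range (ExteriorAlgebra.ι ℂ (M := A.H1)) * A.cohDegree n := pow_succ' _ _
    rw [h1]
    refine (mul_le_mul_right ih _).trans ?_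
    simp only [Submodule.mul_iSup]
    refine iSup_le fun p => iSup_le fun q => iSup_le fun hpq => ?_
    rw [hR, Submodule.sup_mul]
    refine sup_le ?_ ?_
    · refine le_iSup_of_le (p + 1) (le_iSup_of_le q (le_iSup_of_le (by omega) ?_))
      rw [hodgeNat, hodgeNat, ← mul_assoc, ← pow_succ']
    · refine le_iSup_of_le p (le_iSup_of_le (q + 1) (le_iSup_of_le (by omega) ?_))
      rw [hodgeNat, hodgeNat, ← mul_assoc, (hcomm.pow_right p).eq, mul_assoc, ← pow_succ']

/-- In `Hⁿ(A, ℂ)` the circle determines the Hodge type. -/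
theorem mem_hodge_of_mem_circleEigenspace {n : ℕ} {x : A.Coh} (hn : x ∈ A.cohDegree n) {p q : ℤ}
    (hpq : p + q = n) (hx : x ∈ A.circleEigenspace (p - q)) : x ∈ A.hodge p q := by
  have h1 : A.cohDegree n ≤ A.hodge p q ⊔ ⨆ (j : ℤ) (_ : j ≠ p - q), A.circleEigenspace j := by
    refine (cohDegree_le_iSup_hodgeNat n).trans ?_
    refine iSup_le fun a => iSup_le fun b => iSup_le fun hab => ?_
    have h2 : A.hodgeNat a b = A.hodge a b := by
      rw [hodge, if_pos ⟨Int.natCast_nonneg a, Int.natCast_nonneg b⟩, Int.toNat_natCast,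
        Int.toNat_natCast]
    rw [h2]
    by_cases h : (a : ℤ) - b = p - q
    · have ha : (a : ℤ) = p := by omega
      have hb : (b : ℤ) = q := by omega
      rw [ha, hb]
      exact le_sup_left
    · exact (hodge_le_circleEigenspace _ _).trans
        (le_sup_of_le_right (le_iSup₂_of_le (f := fun j (_ : j ≠ p - q) => A.circleEigenspace j)
          ((a : ℤ) - b) h le_rfl))
  obtain ⟨y, hy, z, hz, rfl⟩ := Submodule.mem_sup.1 (h1 hn)
  have h3 : z ∈ A.circleEigenspace (p - q) := by
    have := sub_mem hx (hodge_le_circleEigenspace p q hy)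
    rwa [add_sub_cancel_left] at this
  have h4 : z = 0 := Submodule.disjoint_def.1 (iSupIndep_circleEigenspace (p - q)) z h3 hz
  rwa [h4, add_zero]

end ComplexAbelianVariety

namespace ComplexAbelianVariety

variable {A B : ComplexAbelianVariety}

/-! ### Hodge substructures of cohomology as modules over the Hodge group -/

/-- The complexification of a Hodge structure in the cohomology of `A` is stable under the Hodge
group. -/
theorem hodgeGroup_le_cohStabilizer_of_isHodgeSub {n : ℕ} {W : Submodule ℚ A.Coh}
    {S : HodgeStructure W} (hS : IsHodgeSub n W S) :
    A.hodgeGroup ≤ cohStabilizer (Submodule.span ℂ (W : Set A.Coh)) := by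
  refine hodgeGroup_le (isRationalAlgebraic_cohStabilizer
    (hS.1.trans (A.cohOver_le_totalCohOver ℚ n))) fun u hu h1 => ?_
  rw [mem_cohStabilizer_iff, ← range_toComplex]
  rintro _ ⟨z, rfl⟩
  have hz : z ∈ ⨆ pq : ℤ × ℤ, S.piece pq.1 pq.2 := by
    rw [S.iSup_piece]; trivial
  induction hz using Submodule.iSup_induction' with
  | mem i z hz =>
    rw [act_scalarAut_of_mem_hodge hu h1 (hS.2.2 i.1 i.2 ⟨z, hz, rfl⟩)]
    exact Submodule.smul_mem _ _ ⟨z, rfl⟩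
  | zero => simp
  | add x y _ _ hx hy => rw [map_add, map_add]; exact add_mem hx hy

/-- A nonzero submodule of `H^⋆(A, k)` under the Hodge group contains an irreducible one. -/
theorem exists_irreducible_le {k : Type*} [Field k] [Algebra k ℂ] {M : Submodule k A.Coh}
    (hM : IsHodgeGroupSubmodule M) (h0 : M ≠ ⊥) :
    ∃ V ≤ M, IsIrreducibleHodgeGroupSubmodule V := by
  have hfin : FiniteDimensional k (A.totalCohOver k) := by
    rw [totalCohOver_eq_span]
    exact FiniteDimensional.span_of_finite k (Set.finite_range _)
  have hfin' : ∀ V ≤ M, FiniteDimensional k V := fun V hV =>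
    Submodule.finiteDimensional_of_le (hV.trans hM.1)
  let 𝒮 := {V : Submodule k A.Coh | V ≤ M ∧ IsHodgeGroupSubmodule V ∧ V ≠ ⊥}
  let V := Function.argminOn (fun V : Submodule k A.Coh => Module.finrank k V) 𝒮
    ⟨M, le_rfl, hM, h0⟩
  obtain ⟨hVM, hV, hV0⟩ : V ∈ 𝒮 := Function.argminOn_mem _ _ _
  have hmin : ∀ U ∈ 𝒮, Module.finrank k V ≤ Module.finrank k U := fun U hU =>
    Function.argminOn_le (fun V : Submodule k A.Coh => Module.finrank k V) _ hU
  refine ⟨V, hVM, hV, hV0, fun U hU hUV => ?_⟩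
  by_cases hU0 : U = ⊥
  · exact Or.inl hU0
  · have := hfin' V hVM
    exact Or.inr (Submodule.eq_of_le_of_finrank_le hUV (hmin U ⟨hUV.trans hVM, hU, hU0⟩))

/-- An isomorphism `V ≅ V'` of modules over `G(A × B)` extends to an equivariant map on all
of `H^⋆(A, ℂ)`, by complete reducibility. -/
theorem exists_equivariant_extension {k : Type*} [Field k] [Algebra k ℂ] {n : ℕ}
    {V : Submodule k A.Coh} {V' : Submodule k B.Coh} (hVn : V ≤ A.cohOver k n)
    (hV : IsHodgeGroupSubmodule V) (hVV' : IsomorphicOverProd V V') :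
    ∃ Ψ : A.Coh →ₗ[ℂ] B.Coh,
      (∀ x, Ψ x ∈ Submodule.span ℂ (V' : Set B.Coh)) ∧
      (∀ y ∈ Submodule.span ℂ (V' : Set B.Coh), ∃ x ∈ Submodule.span ℂ (V : Set A.Coh), Ψ x = y) ∧
      ∀ (g : A.H1 ≃ₗ[ℂ] A.H1) (h : B.H1 ≃ₗ[ℂ] B.H1), blockSum g h ∈ (A.prod B).hodgeGroup →
        ∀ x, Ψ (act g x) = act h (Ψ x) := by
  obtain ⟨e, he⟩ := hVV'
  obtain ⟨d, o, ho⟩ := A.exists_basis_adjoint_mem_hodgeGroup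
  have hVn' : Submodule.span ℂ (V : Set A.Coh) ≤ A.cohDegree n :=
    Submodule.span_le.2 fun x hx => A.cohOver_le_cohDegree k n (hVn hx)
  obtain ⟨P, hPV, hP1, hPg⟩ := exists_equivariant_projection o (A.hodgeGroup : Set _) ho n
    (Submodule.span ℂ (V : Set A.Coh)) hVn' hV.2
  obtain ⟨r, hr⟩ := LinearMap.exists_leftInverse_of_injective (toComplex V)
    (LinearMap.ker_eq_bot.2 (toComplex_injective hV.1))
  have hr' : ∀ z, r (toComplex V z) = z := LinearMap.congr_fun hr
  let Ψ : A.Coh →ₗ[ℂ] B.Coh := toComplex V' ∘ₗ e.toLinearMap.baseChange ℂ ∘ₗ r ∘ₗ P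
  have hΨ : ∀ x z, P x = toComplex V z → Ψ x = toComplex V' (e.toLinearMap.baseChange ℂ z) := by
    intro x z h
    change toComplex V' (e.toLinearMap.baseChange ℂ (r (P x))) = _
    rw [h, hr']
  refine ⟨Ψ, fun x => ?_, fun y hy => ?_, fun g h hgh x => ?_⟩
  · rw [← range_toComplex]
    exact ⟨_, rfl⟩
  · rw [← range_toComplex] at hy
    obtain ⟨z', rfl⟩ := hy
    obtain ⟨z, rfl⟩ : ∃ z, e.toLinearMap.baseChange ℂ z = z' :=
      (e.baseChange k ℂ V V').surjective z'
    have hz : toComplex V z ∈ Submodule.span ℂ (V : Set A.Coh) := by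
      rw [← range_toComplex]
      exact ⟨z, rfl⟩
    exact ⟨toComplex V z, hz, hΨ _ _ (hP1 _ hz)⟩
  · have hx := hPV x
    have hgx := hPV (act g x)
    rw [← range_toComplex] at hx hgx
    obtain ⟨z, hz⟩ := hx
    obtain ⟨y, hy⟩ := hgx
    rw [hΨ _ _ hz.symm, hΨ _ _ hy.symm]
    refine he g h hgh z y ?_
    rw [hy, hz]
    exact hPg g (mem_hodgeGroup_of_blockSum_mem hgh) x

/-! ### Hodge substructures from rational equivariant maps -/

theorem iSupIndep_circleEigenspace_weight (n : ℕ) :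
    iSupIndep fun pq : ℤ × ℤ => if pq.1 + pq.2 = n then A.circleEigenspace (pq.1 - pq.2) else ⊥ := by
  intro i
  by_cases hi : i.1 + i.2 = n
  · refine ((iSupIndep_circleEigenspace (A := A)) (i.1 - i.2)).mono ?_ ?_
    · simp only [if_pos hi]
      exact le_rfl
    · refine iSup₂_le fun j hj => ?_
      dsimp only
      split_ifs with h
      · refine le_iSup₂_of_le (f := fun l (_ : l ≠ i.1 - i.2) => A.circleEigenspace l)
          (j.1 - j.2) (fun h' => hj ?_) le_rfl
        ext <;> omega
      · exact bot_le
  · simp only [if_neg hi]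
    exact disjoint_bot_left

theorem blockSum_circleGen_mem : blockSum A.circleGen B.circleGen ∈ (A.prod B).hodgeGroup := by
  rw [circleGen, circleGen, ← scalarAut_prod]
  exact scalarAut_mem_hodgeGroup _ _ _ norm_exp_I

theorem map_mem_circleEigenspace {Ψ : A.Coh →ₗ[ℂ] B.Coh}
    (hΨ : ∀ x, Ψ (act A.circleGen x) = act B.circleGen (Ψ x)) {j : ℤ} {x : A.Coh}
    (hx : x ∈ A.circleEigenspace j) : Ψ x ∈ B.circleEigenspace j := by
  rw [mem_circleEigenspace] at hx ⊢
  rw [← hΨ, hx, map_smul]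

/-- A rational map `Hⁿ(A, ℚ) → Hⁿ'(B, ℚ)` which commutes with the circle embeds an irreducible
Hodge structure `W`, unless it kills `W`; its image is then a Tate twist of `W`. If some class
of type `(p, q)` in `W` has a nonzero image of type `(n', 0)`, the image is fully twisted. -/
theorem exists_isHodgeSub_of_equivariant {n n' : ℕ} {W : Submodule ℚ A.Coh} {S : HodgeStructure W}
    (hS : IsHodgeSub n W S) (hirr : S.IsIrreducible) {Φ : A.Coh →ₗ[ℂ] B.Coh}
    (hΦ : ∀ x, Φ (act A.circleGen x) = act B.circleGen (Φ x))
    (hΦQ : ∀ x ∈ A.totalCohOver ℚ, Φ x ∈ B.cohOver ℚ n') {p q : ℤ} (hpq : p - q = n')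
    {z : ℂ ⊗[ℚ] W} (hz : z ∈ S.piece p q) (hz0 : Φ (toComplex W z) ≠ 0) :
    ∃ (W' : Submodule ℚ B.Coh) (S' : HodgeStructure W'),
      IsHodgeSub n' W' S' ∧ S'.IsFullyTwisted ∧ ∃ m : ℤ, S'.Isomorphic (S.tateTwist m) := by
  have hpqn : p + q = n := by
    by_contra h
    rw [S.piece_eq_bot p q (by rw [hS.2.1]; exact h), Submodule.mem_bot] at hz
    rw [hz, map_zero, map_zero] at hz0
    exact hz0 rfl
  let φ : W →ₗ[ℚ] B.Coh := Φ.restrictScalars ℚ ∘ₗ W.subtype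
  have hφn : LinearMap.range φ ≤ B.cohOver ℚ n' := by
    rintro _ ⟨w, rfl⟩
    exact hΦQ _ (A.cohOver_le_totalCohOver ℚ n (hS.1 w.2))
  let W' := LinearMap.range φ
  let f : W →ₗ[ℚ] W' := φ.rangeRestrict
  have hf : ∀ x, toComplex W' (f.baseChange ℂ x) = Φ (toComplex W x) := by
    have : toComplex W' ∘ₗ f.baseChange ℂ = Φ ∘ₗ toComplex W := by
      ext w
      simp [toComplex, f, φ]
    exact LinearMap.congr_fun this
  have hinj' : Function.Injective (toComplex W') :=
    toComplex_injective (hφn.trans (B.cohOver_le_totalCohOver ℚ n'))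
  have hdeg : ∀ x, toComplex W' x ∈ B.cohDegree n' := by
    intro x
    have h1 : Submodule.span ℂ (W' : Set B.Coh) ≤ B.cohDegree n' :=
      Submodule.span_le.2 fun y hy => B.cohOver_le_cohDegree ℚ n' (hφn hy)
    apply h1
    rw [← range_toComplex]
    exact ⟨x, rfl⟩
  have htype : ∀ a b, ∀ x ∈ S.piece a b, Φ (toComplex W x) ∈ B.circleEigenspace (a - b) :=
    fun a b x hx => map_mem_circleEigenspace hΦ
      (hodge_le_circleEigenspace a b (hS.2.2 a b ⟨x, hx, rfl⟩))
  have hf0 : f ≠ 0 := by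
    intro h
    rw [← hf, h, LinearMap.baseChange_zero, LinearMap.zero_apply, map_zero] at hz0
    exact hz0 rfl
  have hfinj : Function.Injective f := by
    refine (hirr.eq_zero_or_injective f
      (fun ab => (if ab.1 + ab.2 = n then B.circleEigenspace (ab.1 - ab.2) else ⊥).comap
        (toComplex W')) ?_ fun a b x hx => ?_).resolve_left hf0
    · intro i
      have h1 := iSupIndep_circleEigenspace_weight (A := B) n i
      rw [Submodule.disjoint_def] at h1 ⊢
      intro x hx hx'
      apply hinj'
      rw [map_zero]
      refine h1 _ hx ?_
      have h2 : (⨆ j, ⨆ (_ : j ≠ i), (if j.1 + j.2 = (n : ℤ) then B.circleEigenspace (j.1 - j.2)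
          else ⊥).comap (toComplex W')) ≤
          (⨆ j : ℤ × ℤ, ⨆ (_ : j ≠ i), if j.1 + j.2 = (n : ℤ) then
            B.circleEigenspace (j.1 - j.2) else ⊥).comap (toComplex W') :=
        iSup₂_le fun j hj => Submodule.comap_mono (le_iSup₂_of_le (f := fun (j : ℤ × ℤ)
          (_ : j ≠ i) => if j.1 + j.2 = (n : ℤ) then
            B.circleEigenspace (j.1 - j.2) else ⊥) j hj le_rfl)
      exact h2 hx'
    · rw [Submodule.mem_comap, hf]
      by_cases h : a + b = n
      · simp only [if_pos h]
        exact htype a b x hx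
      · rw [S.piece_eq_bot a b (by rw [hS.2.1]; exact h), Submodule.mem_bot] at hx
        rw [hx, map_zero, map_zero]
        exact zero_mem _
  let e : W ≃ₗ[ℚ] W' := LinearEquiv.ofBijective f ⟨hfinj, φ.surjective_rangeRestrict⟩
  let S' := (S.tateTwist q).transport e
  have hpiece : ∀ a b, ∀ y ∈ S'.piece a b, toComplex W' y ∈ B.hodge a b := by
    rintro a b _ ⟨x, hx, rfl⟩
    have hx : x ∈ S.piece (a + q) (b + q) := hx
    by_cases h : a + b = n'
    · refine mem_hodge_of_mem_circleEigenspace (hdeg _) h ?_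
      have := htype _ _ x hx
      rw [← hf, add_sub_add_right_eq_sub] at this
      exact this
    · rw [S.piece_eq_bot _ _ (by rw [hS.2.1]; omega), Submodule.mem_bot] at hx
      rw [hx, map_zero, map_zero]
      exact zero_mem _
  refine ⟨W', S', ⟨hφn, ?_, fun a b => ?_⟩, ⟨fun a b hab => ?_, fun heff => ?_⟩, q,
    HodgeStructure.transport_isomorphic _ _⟩
  · change S.weight - 2 * q = n'
    rw [hS.2.1]
    omega
  · rintro _ ⟨y, hy, rfl⟩
    exact hpiece a b y hy
  · obtain ⟨y, hy, hy0⟩ := Submodule.exists_mem_ne_zero_of_ne_bot hab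
    have h1 := hpiece a b y hy
    rw [hodge] at h1
    split_ifs at h1 with h
    · exact h
    · rw [Submodule.mem_bot] at h1
      exact absurd (hinj' (h1.trans (map_zero _).symm)) hy0
  · -- The class of type `(n', 0)` has type `(n' - 1, -1)` in the twist.
    have h1 : f.baseChange ℂ z ∈ (S'.tateTwist 1).piece (n' - 1) (-1) := by
      refine ⟨z, ?_, rfl⟩
      change z ∈ S.piece (n' - 1 + 1 + q) (-1 + 1 + q)
      have e1 : (n' : ℤ) - 1 + 1 + q = p := by omega
      have e2 : (-1 : ℤ) + 1 + q = q := by omega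
      rwa [e1, e2]
    have h2 : (S'.tateTwist 1).piece (n' - 1) (-1) ≠ ⊥ := by
      intro h
      rw [h, Submodule.mem_bot] at h1
      rw [← hf, h1, map_zero] at hz0
      exact hz0 rfl
    have := (heff _ _ h2).2
    omega

theorem IsDominatedOver.isDominatedBy {k : Type*} [Field k] [Algebra k ℂ]
    {𝒜 : Set ComplexAbelianVariety} (h : A.IsDominatedOver k 𝒜) : A.IsDominatedBy 𝒜 := by
  intro n W S hS hirr
  have : CharZero k := ((algebraMap k ℂ).charZero_iff (algebraMap k ℂ).injective).2 inferInstance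
  -- An irreducible submodule `V` of `k W`.
  let M : Submodule k A.Coh := Submodule.span k (W : Set A.Coh)
  have hMn : M ≤ A.cohOver k n := by
    refine Submodule.span_le.2 fun w hw => ?_
    have hw' := hS.1 hw
    rw [cohOver_eq_span] at hw' ⊢
    exact Submodule.span_subset_span ℚ k _ hw'
  have hMC : Submodule.span ℂ (M : Set A.Coh) = Submodule.span ℂ (W : Set A.Coh) :=
    Submodule.span_span_of_tower k ℂ _
  have hM : IsHodgeGroupSubmodule M := by
    refine ⟨hMn.trans (A.cohOver_le_totalCohOver k n), fun g hg => ?_⟩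
    rw [hMC]
    exact mem_cohStabilizer_iff.1 (hodgeGroup_le_cohStabilizer_of_isHodgeSub hS hg)
  have hM0 : M ≠ ⊥ := by
    obtain ⟨w, hw⟩ := @exists_ne _ hirr.1 (0 : W)
    intro h0
    have : (w : A.Coh) ∈ M := Submodule.subset_span w.2
    rw [h0, Submodule.mem_bot] at this
    exact hw (Subtype.ext this)
  obtain ⟨V, hVM, hV⟩ := exists_irreducible_le hM hM0
  obtain ⟨B, hB, n', V', hV'n, -, hVV', ω, hωV', hω0, hω⟩ := h V hV
  obtain ⟨Ψ, hΨV', hΨsurj, hΨ⟩ := exists_equivariant_extension (hVM.trans hMn) hV.1 hVV'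
  have hΨn : ∀ x, Ψ x ∈ B.cohDegree n' := by
    have : Submodule.span ℂ (V' : Set B.Coh) ≤ B.cohDegree n' :=
      Submodule.span_le.2 fun y hy => B.cohOver_le_cohDegree k n' (hV'n hy)
    exact fun x => this (hΨV' x)
  obtain ⟨x, hxV, rfl⟩ := hΨsurj ω hωV'
  obtain ⟨z, rfl⟩ : ∃ z, toComplex W z = x := by
    have h1 : x ∈ Submodule.span ℂ (W : Set A.Coh) := by
      rw [← hMC]
      exact Submodule.span_mono hVM hxV
    rwa [← range_toComplex] at h1
  -- Some component of `z` of type `(p, q)` with `p - q = n'` has a nonzero image.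
  obtain ⟨p, q, hpq, y, hy, hy0⟩ : ∃ p q : ℤ, p - q = n' ∧ ∃ y ∈ S.piece p q,
      Ψ (toComplex W y) ≠ 0 := by
    by_contra! hcon
    have h1 : Ψ (toComplex W z) ∈ ⨆ (j : ℤ) (_ : j ≠ n'), B.circleEigenspace j := by
      have hz : z ∈ ⨆ pq : ℤ × ℤ, S.piece pq.1 pq.2 := by
        rw [S.iSup_piece]; trivial
      clear hxV hω0 hω hωV'
      induction hz using Submodule.iSup_induction' with
      | mem i y hy =>
        by_cases hi : i.1 - i.2 = n'
        · rw [hcon i.1 i.2 hi y hy]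
          exact zero_mem _
        · exact (le_iSup₂_of_le (f := fun (j : ℤ) (_ : j ≠ n') => B.circleEigenspace j)
            (i.1 - i.2) hi le_rfl) (map_mem_circleEigenspace (hΨ _ _ blockSum_circleGen_mem)
              (hodge_le_circleEigenspace _ _ (hS.2.2 _ _ ⟨y, hy, rfl⟩)))
      | zero => simp
      | add a b _ _ ha hb => rw [map_add, map_add]; exact add_mem ha hb
    have h2 := hodge_le_circleEigenspace _ _ hω
    rw [sub_zero] at h2
    exact hω0 (Submodule.disjoint_def.1 (iSupIndep_circleEigenspace (n' : ℤ)) _ h2 h1)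
  obtain ⟨m, c, Φ, hΨΦ, hΦQ, hΦ⟩ := exists_rational_equivariant_components hΨ hΨn
  obtain ⟨i, hi⟩ : ∃ i, Φ i (toComplex W y) ≠ 0 := by
    by_contra! hcon
    exact hy0 (by rw [hΨΦ]; simp [hcon])
  obtain ⟨W', S', h1, h2, h3⟩ := exists_isHodgeSub_of_equivariant hS hirr
    (hΦ i _ _ blockSum_circleGen_mem) (hΦQ i) hpq hy hi
  exact ⟨B, hB, n', W', S', h1, h2, h3⟩

end ComplexAbelianVariety

end

theorem lemma3p2 (A : ComplexAbelianVariety) (𝒜 : Set ComplexAbelianVariety) (k : Subfield ℂ)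
    (h : A.IsDominatedOver k 𝒜) : A.IsDominatedBy 𝒜 := by
  exact h.isDominatedBy
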